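/- Let $d\ge 1$ and let $\Omega\subset\mathbb{R}^d$ be a bounded domain (a bounded non-empty open set; connectedness is not needed). Let $H^1_0(\Omega)$ be the closure of $C_c^\infty(\Omega)$ in the $H^1$ norm. The eigenvalues of the Dirichlet Laplacian on $\Omega$ are the numbers $\mu$ for which there is $u\in H^1_0(\Omega)$, $u\neq 0$, with $\int_\Omega\nabla u\cdot\nabla v=\mu\int_\Omega uv$ for all $v\in H^1_0(\Omega)$. They can be listed, with multiplicity, as a sequence $0<\lambda_1\le\lambda_2\le\cdots$ with $\lambda_k\to\infty$. For real $\sigma$ and $z$ define the Riesz mean $$R_\sigma(z)=\sum_{k:\ \lambda_k<z}(z-\lambda_k)^\sigma ,$$ which is $\sum_k (z-\lambda_k)_+^\sigma$ if $\sigma>0$, and $\#\{k:\lambda_k<z\}=\lim_{\sigma\downarrow 0}R_\sigma(z)$ if $\sigma=0$. 1. Let $0<\sigma\le 2$. For all $z\ge\lambda_1$, $$R_{\sigma-1}(z)\ \ge\ \Bigl(1+\frac d4\Bigr)\frac1z\,R_\sigma(z),\qquad R_\sigma'(z)\ \ge\ \Bigl(1+\frac d4\Bigr)\frac{\sigma}{z}\,R_\sigma(z),$$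 and $z\mapsto R_\sigma(z)/z^{\sigma+d\sigma/4}$ is nondecreasing on $[\lambda_1,\infty)$. Here $R_\sigma$ is differentiable at $z$ if $\sigma>1$ or if $z$ is not an eigenvalue; in the remaining case ($\sigma\le 1$ and $z$ an eigenvalue) the inequality for $R_\sigma'$ means that $\liminf_{w\to z}\frac{R_\sigma(w)-R_\sigma(z)}{w-z}\ge\bigl(1+\frac d4\bigr)\frac{\sigma}{z}R_\sigma(z)$. 2. Let $\sigma\ge 2$. For all $z\ge\lambda_1$, $R_\sigma$ is differentiable at $z$, $$R_{\sigma-1}(z)\ \ge\ \Bigl(1+\frac d{2\sigma}\Bigr)\frac1z\,R_\sigma(z),\qquad R_\sigma'(z)\ \ge\ \Bigl(\sigma+\frac d2\Bigr)\frac1z\,R_\sigma(z),$$ and $z\mapsto R_\sigma(z)/z^{\sigma+d/2}$ is nondecreasing on $[\lambda_1,\infty)$. -/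

import Mathlib

open MeasureTheory Filter Topology TopologicalSpace
open scoped Distributions

noncomputable section

/-- `L²(Ω)`, real valued. -/
abbrev L2 {d : ℕ} (Ω : Opens (EuclideanSpace ℝ (Fin d))) : Type :=
  Lp ℝ 2 (volume.restrict (Ω : Set (EuclideanSpace ℝ (Fin d))))

/-- `L²(Ω; ℝᵈ)`, square integrable vector fields. -/
abbrev L2Vec {d : ℕ} (Ω : Opens (EuclideanSpace ℝ (Fin d))) : Type :=
  Lp (EuclideanSpace ℝ (Fin d)) 2 (volume.restrict (Ω : Set (EuclideanSpace ℝ (Fin d))))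

/-- The Hilbert space `L²(Ω) × L²(Ω; ℝᵈ)`; via `u ↦ (u, ∇u)` the norm of `H¹(Ω)` is the norm of
this space. -/
abbrev L2Pair {d : ℕ} (Ω : Opens (EuclideanSpace ℝ (Fin d))) : Type :=
  WithLp 2 (L2 Ω × L2Vec Ω)

/-- The pairs `(φ, ∇φ)` with `φ ∈ C_c^∞(Ω)`. -/
def testGraph {d : ℕ} (Ω : Opens (EuclideanSpace ℝ (Fin d))) : Submodule ℝ (L2Pair Ω) where
  carrier := {p | ∃ φ : 𝓓(Ω, ℝ),
    (p.fst =ᵐ[volume.restrict (Ω : Set (EuclideanSpace ℝ (Fin d)))] fun x => φ x) ∧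
    (p.snd =ᵐ[volume.restrict (Ω : Set (EuclideanSpace ℝ (Fin d)))] fun x => gradient φ x)}
  zero_mem' := by
    refine ⟨0, ?_, ?_⟩
    · filter_upwards [Lp.coeFn_zero ℝ 2
        (volume.restrict (Ω : Set (EuclideanSpace ℝ (Fin d))))] with x hx
      simpa using hx
    · filter_upwards [Lp.coeFn_zero (EuclideanSpace ℝ (Fin d)) 2
        (volume.restrict (Ω : Set (EuclideanSpace ℝ (Fin d))))] with x hx
      simpa [gradient] using hx
  add_mem' := by
    rintro p q ⟨φ, h1, h2⟩ ⟨ψ, h3, h4⟩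
    refine ⟨φ + ψ, ?_, ?_⟩
    · filter_upwards [Lp.coeFn_add p.fst q.fst, h1, h3] with x hx h1 h3
      refine hx.trans ?_
      simp [h1, h3]
    · filter_upwards [Lp.coeFn_add p.snd q.snd, h2, h4] with x hx h2 h4
      have e1 : DifferentiableAt ℝ φ x := (φ.contDiff.differentiable (by simp)) x
      have e2 : DifferentiableAt ℝ ψ x := (ψ.contDiff.differentiable (by simp)) x
      refine hx.trans ?_
      simp [h2, h4, gradient, fderiv_add e1 e2]
  smul_mem' := by
    rintro c p ⟨φ, h1, h2⟩
    refine ⟨c • φ, ?_, ?_⟩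
    · filter_upwards [Lp.coeFn_smul c p.fst, h1] with x hx h1
      simp [hx, h1]
    · filter_upwards [Lp.coeFn_smul c p.snd, h2] with x hx h2
      have e1 : DifferentiableAt ℝ φ x := (φ.contDiff.differentiable (by simp)) x
      simp [hx, h2, gradient, fderiv_const_smul e1]

/-- The Sobolev space `H¹₀(Ω)`, the closure of `C_c^∞(Ω)` in the `H¹` norm. A function `u` is
represented by the pair `(u, ∇u)`; the second component of a limit of pairs `(φₙ, ∇φₙ)` is the
weak gradient of the first, and so is determined by it. -/
def H10 {d : ℕ} (Ω : Opens (EuclideanSpace ℝ (Fin d))) : Submodule ℝ (L2Pair Ω) :=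
  (testGraph Ω).topologicalClosure

/-- The eigenspace of the Dirichlet Laplacian `-Δ` on `Ω` for the value `μ`: all `u ∈ H¹₀(Ω)` with
`-Δu = μ u` weakly, that is `∫_Ω ∇u · ∇v = μ ∫_Ω u v` for every `v ∈ H¹₀(Ω)`. -/
def dirichletEigenspace {d : ℕ} (Ω : Opens (EuclideanSpace ℝ (Fin d))) (μ : ℝ) :
    Submodule ℝ (H10 Ω) where
  carrier := {u | ∀ v : H10 Ω,
    inner ℝ (u : L2Pair Ω).snd (v : L2Pair Ω).snd =
      μ * inner ℝ (u : L2Pair Ω).fst (v : L2Pair Ω).fst}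
  zero_mem' := by
    intro v
    simp
  add_mem' := by
    intro u w hu hw v
    have h1 := hu v
    have h2 := hw v
    simp only [Submodule.coe_add, WithLp.add_fst, WithLp.add_snd, inner_add_left, h1, h2]
    ring
  smul_mem' := by
    intro c u hu v
    have h1 := hu v
    simp only [Submodule.coe_smul, WithLp.smul_fst, WithLp.smul_snd, real_inner_smul_left, h1]
    ring

/-- `lam 0 ≤ lam 1 ≤ …` is the list of all the eigenvalues of the Dirichlet Laplacian on `Ω`, in
nondecreasing order, each one repeated according to its multiplicity: every real `μ` occurs in the
list exactly `dim (eigenspace of μ)` times. The entry `lam k` is the eigenvalue with index `k + 1`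
in the usual numbering, which starts at `1`. -/
structure IsDirichletSpectrum {d : ℕ} (Ω : Opens (EuclideanSpace ℝ (Fin d)))
    (lam : ℕ → ℝ) : Prop where
  monotone : Monotone lam
  multiplicity : ∀ μ : ℝ,
    Cardinal.mk {k : ℕ // lam k = μ} = Module.rank ℝ (dirichletEigenspace Ω μ)

/-- The Riesz mean `R_σ(z) = ∑ₖ (z - λₖ)₊^σ`, where only the terms with `λₖ < z` contribute. For
`σ > 0` this is the power of the positive part; for `σ = 0` it counts the `λₖ < z`, the limit of
`R_σ(z)` as `σ ↓ 0`; for `σ < 0` it keeps the terms that are defined. -/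
def rieszMean (lam : ℕ → ℝ) (σ z : ℝ) : ℝ :=
  ∑' k, if lam k < z then (z - lam k) ^ σ else 0

end

/-- The Yang inequality in one coordinate direction, in abstract form. -/
theorem yang_inequality_of_commutator {E ι : Type*} [NormedAddCommGroup E] [InnerProductSpace ℝ E]
    [Fintype ι] (lam : ι → ℝ) (z : ℝ) (U X D : ι → E) (hlt : ∀ i, lam i < z)
    (hU : Orthonormal ℝ U) (hX : ∀ i j, inner ℝ (X i) (U j) = inner ℝ (X j) (U i))
    (hcomm : ∀ i j, 2 * inner ℝ (D i) (U j) = (lam i - lam j) * inner ℝ (X i) (U j))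
    (hDX : ∀ i, -2 * inner ℝ (D i) (X i) = 1)
    (hgap : ∀ i, (z - lam i) * ‖X i - ∑ j, inner ℝ (X i) (U j) • U j‖ ^ 2 ≤
      -2 * inner ℝ (D i) (X i - ∑ j, inner ℝ (X i) (U j) • U j)) :
    ∑ i, (z - lam i) ^ 2 ≤ 4 * ∑ i, (z - lam i) * ‖D i‖ ^ 2 := by
  classical
  set g : ι → ι → ℝ := fun i j => inner ℝ (X i) (U j) with hg
  set φ : ι → E := fun i => X i - ∑ j, g i j • U j with hφ
  set W : ι → ℝ := fun i => -2 * inner ℝ (D i) (φ i) with hW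
  have hW1 : ∀ i, W i = 1 + ∑ j, (lam i - lam j) * g i j ^ 2 := by
    intro i
    simp only [hW, hφ, inner_sub_right, inner_sum, real_inner_smul_right, mul_sub, hDX]
    rw [sub_eq_add_neg, Finset.mul_sum, ← Finset.sum_neg_distrib]
    congr 1
    refine Finset.sum_congr rfl fun j _ => ?_
    have := hcomm i j
    simp only [hg]
    linear_combination (inner ℝ (X i) (U j)) * this
  have horth : ∀ i j, inner ℝ (U j) (φ i) = 0 := by
    intro i j
    simp only [hφ, inner_sub_right, inner_sum, real_inner_smul_right,
      orthonormal_iff_ite.1 hU, mul_ite, mul_one, mul_zero, Finset.sum_ite_eq, Finset.mem_univ,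
      if_true, hg]
    rw [real_inner_comm, sub_self]
  have hWD : ∀ i, W i = -2 * inner ℝ (D i - ∑ j, inner ℝ (D i) (U j) • U j) (φ i) := by
    intro i
    simp [hW, inner_sub_left, sum_inner, real_inner_smul_left, horth]
  have hDn : ∀ i, ‖D i - ∑ j, inner ℝ (D i) (U j) • U j‖ ^ 2 =
      ‖D i‖ ^ 2 - ∑ j, inner ℝ (D i) (U j) ^ 2 := by
    intro i
    rw [norm_sub_sq_real, ← real_inner_self_eq_norm_sq (∑ j, _)]
    simp only [inner_sum, sum_inner, real_inner_smul_right, real_inner_smul_left,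
      orthonormal_iff_ite.1 hU, mul_ite, mul_one, mul_zero, Finset.sum_ite_eq',
      Finset.mem_univ, if_true]
    simp only [← pow_two]
    ring
  have key : ∀ i, (z - lam i) * W i ≤ 4 * (‖D i‖ ^ 2 - ∑ j, inner ℝ (D i) (U j) ^ 2) := by
    intro i
    have hz : 0 < z - lam i := sub_pos.2 (hlt i)
    have h1 : (z - lam i) * ‖φ i‖ ^ 2 ≤ W i := hgap i
    have h0 : 0 ≤ W i := le_trans (by positivity) h1
    rw [← hDn]
    set P := D i - ∑ j, inner ℝ (D i) (U j) • U j
    rcases h0.eq_or_lt with h | h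
    · rw [← h, mul_zero]; positivity
    · have h2 : W i ^ 2 ≤ 4 * (‖P‖ ^ 2 * ‖φ i‖ ^ 2) := by
        rw [hWD i]
        have := real_inner_mul_inner_self_le P (φ i)
        rw [real_inner_self_eq_norm_sq, real_inner_self_eq_norm_sq] at this
        nlinarith
      have h3 : (z - lam i) * W i * W i ≤ 4 * ‖P‖ ^ 2 * W i := by
        calc (z - lam i) * W i * W i = (z - lam i) * W i ^ 2 := by ring
          _ ≤ (z - lam i) * (4 * (‖P‖ ^ 2 * ‖φ i‖ ^ 2)) := by gcongr
          _ = 4 * ‖P‖ ^ 2 * ((z - lam i) * ‖φ i‖ ^ 2) := by ring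
          _ ≤ 4 * ‖P‖ ^ 2 * W i := by gcongr
      exact le_of_mul_le_mul_right h3 h
  have hsum : ∑ i, (z - lam i) * ((z - lam i) * W i) ≤
      ∑ i, (z - lam i) * (4 * (‖D i‖ ^ 2 - ∑ j, inner ℝ (D i) (U j) ^ 2)) :=
    Finset.sum_le_sum fun i _ => mul_le_mul_of_nonneg_left (key i) (sub_pos.2 (hlt i)).le
  have hL : ∑ i, (z - lam i) * ((z - lam i) * W i) =
      ∑ i, (z - lam i) ^ 2 + ∑ i, ∑ j, (z - lam i) ^ 2 * (lam i - lam j) * g i j ^ 2 := by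
    rw [← Finset.sum_add_distrib]
    refine Finset.sum_congr rfl fun i _ => ?_
    rw [hW1, mul_add, mul_add, Finset.mul_sum, Finset.mul_sum]
    congr 1
    · ring
    · exact Finset.sum_congr rfl fun j _ => by ring
  have hR : ∑ i, (z - lam i) * (4 * (‖D i‖ ^ 2 - ∑ j, inner ℝ (D i) (U j) ^ 2)) =
      4 * ∑ i, (z - lam i) * ‖D i‖ ^ 2 -
        ∑ i, ∑ j, (z - lam i) * (lam i - lam j) ^ 2 * g i j ^ 2 := by
    rw [Finset.mul_sum, ← Finset.sum_sub_distrib]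
    refine Finset.sum_congr rfl fun i _ => ?_
    rw [mul_sub, mul_sub, Finset.mul_sum, Finset.mul_sum]
    congr 1
    · ring
    · refine Finset.sum_congr rfl fun j _ => ?_
      have := hcomm i j
      have h2 : (2 * inner ℝ (D i) (U j)) ^ 2 = ((lam i - lam j) * g i j) ^ 2 := by rw [this]
      linear_combination (z - lam i) * h2
  have hanti : ∑ i, ∑ j, ((z - lam i) ^ 2 * (lam i - lam j) * g i j ^ 2 +
      (z - lam i) * (lam i - lam j) ^ 2 * g i j ^ 2) = 0 := by
    set A := ∑ i, ∑ j, ((z - lam i) ^ 2 * (lam i - lam j) * g i j ^ 2 +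
      (z - lam i) * (lam i - lam j) ^ 2 * g i j ^ 2) with hA
    have hswap : A = -A := by
      conv_lhs => rw [hA, Finset.sum_comm]
      rw [hA, ← Finset.sum_neg_distrib]
      refine Finset.sum_congr rfl fun i _ => ?_
      rw [← Finset.sum_neg_distrib]
      refine Finset.sum_congr rfl fun j _ => ?_
      rw [show g j i = g i j from hX j i]
      ring
    linarith
  simp only [Finset.sum_add_distrib] at hanti
  rw [hL, hR] at hsum
  linarith

namespace ContinuousLinearMap

variable {E : Type*} [NormedAddCommGroup E] [InnerProductSpace ℝ E] {T : E →L[ℝ] E}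

/-- A compact symmetric operator has finitely many eigenvalues outside a neighbourhood of `0`. -/
theorem finite_setOf_hasEigenvalue_ge (hT : IsCompactOperator T) (hs : T.IsSymmetric) {t : ℝ}
    (ht : 0 < t) : {τ : ℝ | t ≤ τ ∧ Module.End.HasEigenvalue (T : Module.End ℝ E) τ}.Finite := by
  by_contra hinf
  have hinf : {τ : ℝ | t ≤ τ ∧ Module.End.HasEigenvalue (T : Module.End ℝ E) τ}.Infinite := hinf
  let f := hinf.natEmbedding
  have hev : ∀ n, ∃ x : E, ‖x‖ = 1 ∧ T x = (f n : ℝ) • x := by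
    intro n
    obtain ⟨v, hv⟩ := (f n).2.2.exists_hasEigenvector
    have hv0 : ‖v‖ ≠ 0 := norm_ne_zero_iff.2 hv.2
    refine ⟨‖v‖⁻¹ • v, by rw [norm_smul, norm_inv, norm_norm, inv_mul_cancel₀ hv0], ?_⟩
    have := hv.apply_eq_smul
    simp only [coe_coe] at this
    rw [map_smul, this, smul_comm]
  choose x hx1 hx2 using hev
  have horth : ∀ n m, n ≠ m → inner ℝ (x n) (x m) = (0 : ℝ) := by
    intro n m hnm
    have h := hs (x n) (x m)
    simp only [coe_coe, hx2, real_inner_smul_left, real_inner_smul_right] at h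
    have hne : (f n : ℝ) ≠ f m := fun h => hnm (f.injective (Subtype.ext h))
    have : ((f n : ℝ) - f m) * inner ℝ (x n) (x m) = 0 := by linarith
    rcases mul_eq_zero.1 this with h | h
    · exact absurd (sub_eq_zero.1 h) hne
    · exact h
  have hsep : ∀ n m, n ≠ m → t ≤ ‖T (x n) - T (x m)‖ := by
    intro n m hnm
    have hn : t ≤ f n := (f n).2.1
    have h1 : ‖T (x n) - T (x m)‖ ^ 2 = (f n : ℝ) ^ 2 + (f m : ℝ) ^ 2 := by
      rw [norm_sub_sq_real, hx2, hx2, real_inner_smul_left, real_inner_smul_right, horth n m hnm,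
        norm_smul, norm_smul, hx1, hx1]
      simp
    refine le_of_sq_le_sq ?_ (norm_nonneg _)
    rw [h1]
    nlinarith [sq_nonneg (f m : ℝ)]
  have hc := hT.isCompact_closure_image_closedBall (f := (T : E →ₗ[ℝ] E)) 1
  obtain ⟨a, -, ψ, hψ, hlim⟩ := hc.tendsto_subseq (x := fun n => T (x n)) fun n =>
    subset_closure ⟨x n, by simp [hx1], rfl⟩
  obtain ⟨N, hN⟩ := Metric.cauchySeq_iff.1 hlim.cauchySeq t ht
  have := hN N le_rfl (N + 1) (Nat.le_succ _)
  rw [dist_eq_norm] at this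
  exact absurd this (not_lt.2 (hsep _ _ (hψ.injective.ne (by simp))))

/-- A compact symmetric positive operator is bounded by `t` on the orthogonal complement of the
eigenspaces for the eigenvalues greater than `t`. -/
theorem inner_apply_self_le_of_orthogonal [CompleteSpace E]
    (hT : IsCompactOperator T) (hs : T.IsSymmetric)
    (hpos : ∀ x, 0 ≤ inner ℝ (T x) x) {t : ℝ} (ht : 0 ≤ t) {w : E}
    (hw : ∀ τ > t, ∀ x, T x = τ • x → inner ℝ x w = (0 : ℝ)) :
    inner ℝ (T w) w ≤ t * ‖w‖ ^ 2 := by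
  let W : Submodule ℝ E := (⨆ τ : Set.Ioi t, Module.End.eigenspace (T : Module.End ℝ E) τ)ᗮ
  have hmem : ∀ v, v ∈ W ↔ ∀ τ > t, ∀ x, T x = τ • x → inner ℝ x v = (0 : ℝ) := by
    intro v
    simp only [W, ← Submodule.iInf_orthogonal, Submodule.mem_iInf, Submodule.mem_orthogonal,
      Module.End.mem_eigenspace_iff, Subtype.forall, Set.mem_Ioi, coe_coe]
  have hinv : ∀ v ∈ W, T v ∈ W := by
    intro v hv
    rw [hmem] at hv ⊢
    intro τ hτ x hx
    have h := hs x v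
    simp only [coe_coe] at h
    rw [← h, hx, real_inner_smul_left, hv τ hτ x hx, mul_zero]
  let S : W →L[ℝ] W := T.restrict hinv
  have hSc : IsCompactOperator S := hT.restrict' hinv
  have hSs : S.IsSymmetric := hs.restrict_invariant hinv
  have hnorm : ‖S‖ ≤ t := by
    have h1 : spectralRadius ℝ S ≤ ENNReal.ofReal t := by
      refine iSup₂_le fun μ hμ => ?_
      by_cases hμ0 : μ = 0
      · simp [hμ0]
      have hev := (hSc.hasEigenvalue_iff_mem_spectrum hμ0).2 hμ
      obtain ⟨v, hv⟩ := hev.exists_hasEigenvector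
      have hv1 : T v = μ • (v : E) := congrArg Subtype.val hv.apply_eq_smul
      have hvn : 0 < inner ℝ (v : E) (v : E) := by
        rw [real_inner_self_eq_norm_sq]
        have : (v : E) ≠ 0 := by simpa using hv.2
        positivity
      have hμpos : 0 ≤ μ := by
        have := hpos v
        rw [hv1, real_inner_smul_left] at this
        exact nonneg_of_mul_nonneg_left this hvn
      have hle : μ ≤ t := by
        by_contra hlt
        exact hvn.ne' ((hmem v).1 v.2 μ (not_le.1 hlt) v hv1)
      rw [← enorm_eq_nnnorm, ← ofReal_norm, Real.norm_of_nonneg hμpos]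
      exact ENNReal.ofReal_le_ofReal hle
    rw [S.spectralRadius_eq_nnnorm hSs.isSelfAdjoint] at h1
    exact (Real.le_toNNReal_iff_coe_le ht).1 (ENNReal.coe_le_coe.1 h1)
  have hwW : w ∈ W := (hmem w).2 hw
  have h2 : inner ℝ (S ⟨w, hwW⟩) (⟨w, hwW⟩ : W) ≤ ‖S ⟨w, hwW⟩‖ * ‖(⟨w, hwW⟩ : W)‖ :=
    real_inner_le_norm _ _
  have h3 : ‖S ⟨w, hwW⟩‖ ≤ t * ‖w‖ := (S.le_of_opNorm_le hnorm _)
  calc inner ℝ (T w) w ≤ ‖S ⟨w, hwW⟩‖ * ‖w‖ := h2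
    _ ≤ t * ‖w‖ * ‖w‖ := by gcongr
    _ = t * ‖w‖ ^ 2 := by ring

end ContinuousLinearMap

noncomputable section

open scoped ENNReal

section Coordinates

variable {d : ℕ} {Ω : Opens (EuclideanSpace ℝ (Fin d))}

theorem memLp_top_coord (hbdd : Bornology.IsBounded (Ω : Set (EuclideanSpace ℝ (Fin d))))
    (a : Fin d) : MemLp (fun x : EuclideanSpace ℝ (Fin d) => x a) ∞
      (volume.restrict (Ω : Set (EuclideanSpace ℝ (Fin d)))) := by
  obtain ⟨C, hC⟩ := hbdd.exists_norm_le
  refine memLp_top_of_bound (by fun_prop) C ?_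
  filter_upwards [ae_restrict_mem Ω.isOpen.measurableSet] with x hx
  exact (PiLp.norm_apply_le x a).trans (hC x hx)

/-- Multiplication by the coordinate `x a`. -/
def mulCoord (hbdd : Bornology.IsBounded (Ω : Set (EuclideanSpace ℝ (Fin d)))) (a : Fin d)
    (F : Type*) [NormedAddCommGroup F] [NormedSpace ℝ F] :
    Lp F 2 (volume.restrict (Ω : Set (EuclideanSpace ℝ (Fin d)))) →L[ℝ]
      Lp F 2 (volume.restrict (Ω : Set (EuclideanSpace ℝ (Fin d)))) :=
  (ContinuousLinearMap.lsmul ℝ ℝ).holderL (volume.restrict (Ω : Set (EuclideanSpace ℝ (Fin d))))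
    ∞ 2 2 (memLp_top_coord hbdd a).toLp

theorem coeFn_mulCoord (hbdd : Bornology.IsBounded (Ω : Set (EuclideanSpace ℝ (Fin d))))
    (a : Fin d) {F : Type*} [NormedAddCommGroup F] [NormedSpace ℝ F]
    (f : Lp F 2 (volume.restrict (Ω : Set (EuclideanSpace ℝ (Fin d))))) :
    mulCoord hbdd a F f =ᵐ[volume.restrict (Ω : Set (EuclideanSpace ℝ (Fin d)))]
      fun x => x a • f x := by
  have h := (ContinuousLinearMap.lsmul ℝ ℝ).coeFn_holder (r := 2)
    ((memLp_top_coord hbdd a).toLp) f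
  filter_upwards [h, (memLp_top_coord hbdd a).coeFn_toLp] with x hx hx'
  rw [← hx']
  exact hx

theorem inner_mulCoord (hbdd : Bornology.IsBounded (Ω : Set (EuclideanSpace ℝ (Fin d))))
    (a : Fin d) {F : Type*} [NormedAddCommGroup F] [InnerProductSpace ℝ F]
    (f g : Lp F 2 (volume.restrict (Ω : Set (EuclideanSpace ℝ (Fin d))))) :
    inner ℝ (mulCoord hbdd a F f) g = inner ℝ f (mulCoord hbdd a F g) := by
  rw [L2.inner_def, L2.inner_def]
  refine integral_congr_ae ?_
  filter_upwards [coeFn_mulCoord hbdd a f, coeFn_mulCoord hbdd a g] with x hf hg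
  rw [hf, hg, real_inner_smul_left, real_inner_smul_right]

variable (Ω) in
/-- The `a`-th coordinate of a square integrable vector field. -/
def coordField (a : Fin d) : L2Vec Ω →L[ℝ] L2 Ω :=
  (EuclideanSpace.proj a : EuclideanSpace ℝ (Fin d) →L[ℝ] ℝ).compLpL 2 _

theorem coeFn_coordField (a : Fin d) (g : L2Vec Ω) :
    coordField Ω a g =ᵐ[volume.restrict (Ω : Set (EuclideanSpace ℝ (Fin d)))] fun x => g x a :=
  ContinuousLinearMap.coeFn_compLpL _ g

variable (Ω) in
/-- The vector field `f e_a`. -/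
def singleField (a : Fin d) : L2 Ω →L[ℝ] L2Vec Ω :=
  (ContinuousLinearMap.toSpanSingleton ℝ (EuclideanSpace.single a (1 : ℝ))).compLpL 2 _

theorem coeFn_singleField (a : Fin d) (f : L2 Ω) :
    singleField Ω a f =ᵐ[volume.restrict (Ω : Set (EuclideanSpace ℝ (Fin d)))]
      fun x => f x • EuclideanSpace.single a (1 : ℝ) := by
  filter_upwards [ContinuousLinearMap.coeFn_compLpL (p := 2)
    (ContinuousLinearMap.toSpanSingleton ℝ (EuclideanSpace.single a (1 : ℝ))) f] with x hx
  simpa [singleField] using hx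

theorem inner_singleField (a : Fin d) (f : L2 Ω) (g : L2Vec Ω) :
    inner ℝ (singleField Ω a f) g = inner ℝ f (coordField Ω a g) := by
  rw [L2.inner_def, L2.inner_def]
  refine integral_congr_ae ?_
  filter_upwards [coeFn_singleField a f, coeFn_coordField a g] with x hf hg
  rw [hf, hg, real_inner_smul_left, EuclideanSpace.inner_single_left]
  simp [mul_comm]

theorem coordField_singleField (a : Fin d) (f : L2 Ω) :
    coordField Ω a (singleField Ω a f) = f := by
  refine Lp.ext ?_
  filter_upwards [coeFn_singleField a f, coeFn_coordField a (singleField Ω a f)] with x hf hg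
  rw [hg, hf]
  simp

theorem coordField_mulCoord (hbdd : Bornology.IsBounded (Ω : Set (EuclideanSpace ℝ (Fin d))))
    (a b : Fin d) (g : L2Vec Ω) :
    coordField Ω a (mulCoord hbdd b _ g) = mulCoord hbdd b _ (coordField Ω a g) := by
  refine Lp.ext ?_
  filter_upwards [coeFn_coordField a g, coeFn_coordField a (mulCoord hbdd b _ g),
    coeFn_mulCoord hbdd b g, coeFn_mulCoord hbdd b (coordField Ω a g)] with x h1 h2 h3 h4
  rw [h2, h3, h4, h1]
  simp

theorem norm_sq_eq_sum_coordField (g : L2Vec Ω) :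
    ‖g‖ ^ 2 = ∑ a, ‖coordField Ω a g‖ ^ 2 := by
  simp only [← real_inner_self_eq_norm_sq, L2.inner_def]
  rw [← integral_finsetSum _ fun a _ => L2.integrable_inner _ _]
  refine integral_congr_ae ?_
  filter_upwards [ae_all_iff.2 fun a => coeFn_coordField (Ω := Ω) a g] with x h
  simp only [h, PiLp.inner_apply]

end Coordinates

section TestFunctions

variable {d : ℕ} {Ω : Opens (EuclideanSpace ℝ (Fin d))}

theorem TestFunction.gradient_apply (φ : 𝓓(Ω, ℝ)) (x : EuclideanSpace ℝ (Fin d)) (a : Fin d) :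
    gradient φ x a = fderiv ℝ φ x (EuclideanSpace.single a 1) := by
  rw [← inner_gradient_left, EuclideanSpace.inner_single_right]
  simp

theorem TestFunction.differentiable (φ : 𝓓(Ω, ℝ)) : Differentiable ℝ φ :=
  φ.contDiff.differentiable (by simp)

theorem TestFunction.continuous_fderiv_apply (φ : 𝓓(Ω, ℝ)) (v : EuclideanSpace ℝ (Fin d)) :
    Continuous fun x => fderiv ℝ φ x v :=
  (φ.contDiff.continuous_fderiv (by simp)).clm_apply continuous_const

theorem TestFunction.continuous_gradient (φ : 𝓓(Ω, ℝ)) : Continuous (gradient φ) :=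
  (InnerProductSpace.toDual ℝ _).symm.continuous.comp (φ.contDiff.continuous_fderiv (by simp))

theorem TestFunction.support_subset (φ : 𝓓(Ω, ℝ)) : Function.support φ ⊆ Ω :=
  (subset_tsupport _).trans φ.tsupport_subset

theorem TestFunction.tsupport_gradient_subset (φ : 𝓓(Ω, ℝ)) :
    tsupport (gradient φ) ⊆ tsupport φ := by
  refine closure_minimal (fun x hx => ?_) (isClosed_tsupport _)
  refine support_fderiv_subset ℝ (f := φ) fun h => hx ?_
  simp [gradient, h]

theorem TestFunction.hasCompactSupport_gradient (φ : 𝓓(Ω, ℝ)) : HasCompactSupport (gradient φ) :=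
  φ.hasCompactSupport.mono' ((subset_tsupport _).trans φ.tsupport_gradient_subset)

/-- The pair `(φ, ∇φ)` as an element of `H¹₀`. -/
def TestFunction.toPair (φ : 𝓓(Ω, ℝ)) : L2Pair Ω :=
  WithLp.toLp 2 ((φ.continuous.memLp_of_hasCompactSupport φ.hasCompactSupport).toLp,
    (φ.continuous_gradient.memLp_of_hasCompactSupport φ.hasCompactSupport_gradient).toLp)

theorem TestFunction.coeFn_toPair_fst (φ : 𝓓(Ω, ℝ)) :
    φ.toPair.fst =ᵐ[volume.restrict (Ω : Set (EuclideanSpace ℝ (Fin d)))] φ :=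
  (φ.continuous.memLp_of_hasCompactSupport φ.hasCompactSupport).coeFn_toLp

theorem TestFunction.coeFn_toPair_snd (φ : 𝓓(Ω, ℝ)) :
    φ.toPair.snd =ᵐ[volume.restrict (Ω : Set (EuclideanSpace ℝ (Fin d)))] gradient φ :=
  (φ.continuous_gradient.memLp_of_hasCompactSupport φ.hasCompactSupport_gradient).coeFn_toLp

theorem mem_testGraph_iff {p : L2Pair Ω} : p ∈ testGraph Ω ↔ ∃ φ : 𝓓(Ω, ℝ), p = φ.toPair := by
  constructor
  · rintro ⟨φ, h1, h2⟩
    refine ⟨φ, (WithLp.ofLp_injective 2) (Prod.ext ?_ ?_)⟩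
    · exact Lp.ext (h1.trans φ.coeFn_toPair_fst.symm)
    · exact Lp.ext (h2.trans φ.coeFn_toPair_snd.symm)
  · rintro ⟨φ, rfl⟩
    exact ⟨φ, φ.coeFn_toPair_fst, φ.coeFn_toPair_snd⟩

theorem TestFunction.toPair_mem_H10 (φ : 𝓓(Ω, ℝ)) : φ.toPair ∈ H10 Ω :=
  (testGraph Ω).le_topologicalClosure (mem_testGraph_iff.2 ⟨φ, rfl⟩)

/-- A closed property that holds for the test functions holds on `H¹₀`. -/
theorem H10_induction {P : L2Pair Ω → Prop} (hP : IsClosed {u | P u})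
    (h : ∀ φ : 𝓓(Ω, ℝ), P φ.toPair) {u : L2Pair Ω} (hu : u ∈ H10 Ω) : P u := by
  refine closure_minimal (s := (testGraph Ω : Set (L2Pair Ω))) (fun p hp => ?_) hP hu
  obtain ⟨φ, rfl⟩ := mem_testGraph_iff.1 hp
  exact h φ

/-- The product of a test function and a coordinate. -/
def TestFunction.mulCoord (φ : 𝓓(Ω, ℝ)) (a : Fin d) : 𝓓(Ω, ℝ) where
  toFun x := x a * φ x
  contDiff' := ContDiff.mul (EuclideanSpace.proj a : EuclideanSpace ℝ (Fin d) →L[ℝ] ℝ).contDiff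
    φ.contDiff
  hasCompactSupport' := φ.hasCompactSupport.mul_left
  tsupport_subset' := (tsupport_mul_subset_right).trans φ.tsupport_subset

theorem TestFunction.gradient_mulCoord (φ : 𝓓(Ω, ℝ)) (a : Fin d)
    (x : EuclideanSpace ℝ (Fin d)) :
    gradient (φ.mulCoord a) x = x a • gradient φ x + φ x • EuclideanSpace.single a (1 : ℝ) := by
  have h1 := (EuclideanSpace.proj a : EuclideanSpace ℝ (Fin d) →L[ℝ] ℝ).hasFDerivAt (x := x)
  have h2 := (φ.differentiable x).hasFDerivAt
  have h3 : HasFDerivAt (φ.mulCoord a) _ x := h1.mul h2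
  ext b
  rw [TestFunction.gradient_apply, h3.fderiv]
  simp [TestFunction.gradient_apply, eq_comm]

/-- Multiplication of `u` by the coordinate `x a`, on pairs `(u, ∇u)`. -/
def mulCoordPair (hbdd : Bornology.IsBounded (Ω : Set (EuclideanSpace ℝ (Fin d)))) (a : Fin d) :
    L2Pair Ω →L[ℝ] L2Pair Ω :=
  ((WithLp.prodContinuousLinearEquiv 2 ℝ (L2 Ω) (L2Vec Ω)).symm : _ →L[ℝ] L2Pair Ω) ∘L
    ((mulCoord hbdd a ℝ ∘L WithLp.fstL 2 ℝ (L2 Ω) (L2Vec Ω)).prod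
      (mulCoord hbdd a _ ∘L WithLp.sndL 2 ℝ (L2 Ω) (L2Vec Ω) +
        singleField Ω a ∘L WithLp.fstL 2 ℝ (L2 Ω) (L2Vec Ω)))

theorem mulCoordPair_fst (hbdd : Bornology.IsBounded (Ω : Set (EuclideanSpace ℝ (Fin d))))
    (a : Fin d) (u : L2Pair Ω) : (mulCoordPair hbdd a u).fst = mulCoord hbdd a ℝ u.fst := rfl

theorem mulCoordPair_snd (hbdd : Bornology.IsBounded (Ω : Set (EuclideanSpace ℝ (Fin d))))
    (a : Fin d) (u : L2Pair Ω) :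
    (mulCoordPair hbdd a u).snd = mulCoord hbdd a _ u.snd + singleField Ω a u.fst := rfl

theorem mulCoordPair_mem_H10 (hbdd : Bornology.IsBounded (Ω : Set (EuclideanSpace ℝ (Fin d))))
    (a : Fin d) {u : L2Pair Ω} (hu : u ∈ H10 Ω) : mulCoordPair hbdd a u ∈ H10 Ω := by
  refine H10_induction (P := fun u => mulCoordPair hbdd a u ∈ H10 Ω) ?_ (fun φ => ?_) hu
  · exact (testGraph Ω).isClosed_topologicalClosure.preimage (mulCoordPair hbdd a).continuous
  · convert (φ.mulCoord a).toPair_mem_H10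
    refine (WithLp.ofLp_injective 2) (Prod.ext ?_ ?_)
    · change (mulCoordPair hbdd a φ.toPair).fst = (φ.mulCoord a).toPair.fst
      refine Lp.ext ?_
      filter_upwards [coeFn_mulCoord hbdd a φ.toPair.fst, φ.coeFn_toPair_fst,
        (φ.mulCoord a).coeFn_toPair_fst] with x h1 h2 h3
      rw [mulCoordPair_fst, h1, h2, h3]
      rfl
    · change (mulCoordPair hbdd a φ.toPair).snd = (φ.mulCoord a).toPair.snd
      refine Lp.ext ?_
      rw [mulCoordPair_snd]
      filter_upwards [coeFn_mulCoord hbdd a φ.toPair.snd, φ.coeFn_toPair_fst, φ.coeFn_toPair_snd,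
        (φ.mulCoord a).coeFn_toPair_snd, coeFn_singleField a φ.toPair.fst,
        Lp.coeFn_add (mulCoord hbdd a _ φ.toPair.snd) (singleField Ω a φ.toPair.fst)]
        with x h1 h2 h3 h4 h5 h6
      rw [h6, Pi.add_apply, h1, h5, h2, h3, h4, TestFunction.gradient_mulCoord]

/-- Integration by parts in `H¹₀`. -/
theorem inner_coordField_eq_neg (a : Fin d) {u v : L2Pair Ω} (hu : u ∈ H10 Ω) (hv : v ∈ H10 Ω) :
    inner ℝ u.fst (coordField Ω a v.snd) = -inner ℝ (coordField Ω a u.snd) v.fst := by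
  have c1 : Continuous fun p : L2Pair Ω => p.fst := (WithLp.fstL 2 ℝ (L2 Ω) (L2Vec Ω)).continuous
  have c2 : Continuous fun p : L2Pair Ω => coordField Ω a p.snd :=
    (coordField Ω a ∘L WithLp.sndL 2 ℝ (L2 Ω) (L2Vec Ω)).continuous
  refine H10_induction (P := fun u : L2Pair Ω => inner ℝ u.fst (coordField Ω a v.snd) =
    -inner ℝ (coordField Ω a u.snd) v.fst) ?_ (fun φ => ?_) hu
  · exact isClosed_eq (c1.inner continuous_const) (c2.inner continuous_const).neg
  refine H10_induction (P := fun v : L2Pair Ω => inner ℝ φ.toPair.fst (coordField Ω a v.snd) =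
    -inner ℝ (coordField Ω a φ.toPair.snd) v.fst) ?_ (fun ψ => ?_) hv
  · exact isClosed_eq (continuous_const.inner c2) (continuous_const.inner c1).neg
  have key : ∀ φ ψ : 𝓓(Ω, ℝ), inner ℝ φ.toPair.fst (coordField Ω a ψ.toPair.snd) =
      ∫ x, φ x * fderiv ℝ ψ x (EuclideanSpace.single a 1) := by
    intro φ ψ
    rw [L2.inner_def]
    have : ∫ x in (Ω : Set (EuclideanSpace ℝ (Fin d))),
        φ x * fderiv ℝ ψ x (EuclideanSpace.single a 1) =
        ∫ x, φ x * fderiv ℝ ψ x (EuclideanSpace.single a 1) :=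
      setIntegral_eq_integral_of_forall_compl_eq_zero fun x hx => by
        rw [Function.notMem_support.1 (fun h => hx (φ.support_subset h)), zero_mul]
    rw [← this]
    refine integral_congr_ae ?_
    filter_upwards [φ.coeFn_toPair_fst, coeFn_coordField a ψ.toPair.snd, ψ.coeFn_toPair_snd]
      with x h1 h2 h3
    rw [h1, h2, h3, TestFunction.gradient_apply]
    simp [mul_comm]
  rw [key, real_inner_comm, key, integral_mul_fderiv_eq_neg_fderiv_mul_of_integrable]
  · simp only [mul_comm]
  · exact ((φ.continuous_fderiv_apply _).mul ψ.continuous).integrable_of_hasCompactSupport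
      ψ.hasCompactSupport.mul_left
  · exact (φ.continuous.mul (ψ.continuous_fderiv_apply _)).integrable_of_hasCompactSupport
      φ.hasCompactSupport.mul_right
  · exact (φ.continuous.mul ψ.continuous).integrable_of_hasCompactSupport
      φ.hasCompactSupport.mul_right
  · exact fun x _ => φ.differentiable x
  · exact fun x _ => ψ.differentiable x

end TestFunctions

section Commutator

variable {d : ℕ} {Ω : Opens (EuclideanSpace ℝ (Fin d))}

theorem neg_two_mul_inner_coordField_mulCoord
    (hbdd : Bornology.IsBounded (Ω : Set (EuclideanSpace ℝ (Fin d))))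
    (a : Fin d) {u : L2Pair Ω} (hu : u ∈ H10 Ω) :
    -2 * inner ℝ (coordField Ω a u.snd) (mulCoord hbdd a ℝ u.fst) = ‖u.fst‖ ^ 2 := by
  have h := inner_coordField_eq_neg a hu (mulCoordPair_mem_H10 hbdd a hu)
  rw [mulCoordPair_snd, mulCoordPair_fst, map_add, coordField_singleField, inner_add_right,
    coordField_mulCoord, ← inner_mulCoord, real_inner_self_eq_norm_sq, real_inner_comm] at h
  linarith

theorem inner_mulCoordPair_snd_of_mem_eigenspace
    (hbdd : Bornology.IsBounded (Ω : Set (EuclideanSpace ℝ (Fin d))))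
    (a : Fin d) {μ : ℝ} {u : H10 Ω} (hu : u ∈ dirichletEigenspace Ω μ) {v : L2Pair Ω}
    (hv : v ∈ H10 Ω) :
    inner ℝ (mulCoordPair hbdd a u).snd v.snd =
      μ * inner ℝ (mulCoord hbdd a ℝ (u : L2Pair Ω).fst) v.fst -
        2 * inner ℝ (coordField Ω a (u : L2Pair Ω).snd) v.fst := by
  have h1 := hu ⟨_, mulCoordPair_mem_H10 hbdd a hv⟩
  have h2 := inner_coordField_eq_neg a u.2 hv
  simp only [mulCoordPair_snd, mulCoordPair_fst] at h1
  rw [inner_add_right, ← inner_mulCoord, ← inner_mulCoord, real_inner_comm (singleField Ω a v.fst),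
    inner_singleField, real_inner_comm _ v.fst] at h1
  rw [mulCoordPair_snd, inner_add_left, inner_singleField]
  linarith

end Commutator

end

noncomputable section

open scoped ENNReal

theorem sq_integral_le_measureReal_mul {α : Type*} [MeasurableSpace α] {μ : Measure α}
    [IsFiniteMeasure μ] {g : α → ℝ} (hg : MemLp g 2 μ) :
    (∫ x, g x ∂μ) ^ 2 ≤ μ.real Set.univ * ∫ x, g x ^ 2 ∂μ := by
  rcases eq_or_ne μ 0 with rfl | hμ
  · simp
  have hm : 0 < μ.real Set.univ := by
    rw [measureReal_def]
    exact ENNReal.toReal_pos (by simpa using hμ) (by simp)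
  set m := μ.real Set.univ
  set c := ∫ x, g x ∂μ with hc
  have i1 : Integrable g μ := hg.integrable one_le_two
  have i2 : Integrable (fun x => g x ^ 2) μ := hg.integrable_sq
  have h : 0 ≤ ∫ x, (m * g x - c) ^ 2 ∂μ := integral_nonneg fun x => sq_nonneg _
  have e : ∫ x, (m * g x - c) ^ 2 ∂μ = m ^ 2 * ∫ x, g x ^ 2 ∂μ - 2 * m * c * c + m * c ^ 2 := by
    have : (fun x => (m * g x - c) ^ 2) = fun x => m ^ 2 * g x ^ 2 - 2 * m * c * g x + c ^ 2 := by
      ext x; ring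
    have i3 : Integrable (fun x => m ^ 2 * g x ^ 2 - 2 * m * c * g x) μ :=
      (i2.const_mul _).sub (i1.const_mul _)
    rw [this, integral_add i3 (integrable_const _), integral_sub (i2.const_mul _) (i1.const_mul _), integral_const_mul, integral_const_mul,
      integral_const, smul_eq_mul, ← hc]
  rw [e] at h
  have : 0 ≤ m * (m * ∫ x, g x ^ 2 ∂μ - c ^ 2) := by linarith
  have := nonneg_of_mul_nonneg_right this hm
  linarith

section Translation

variable {d : ℕ} {Ω : Opens (EuclideanSpace ℝ (Fin d))}

theorem TestFunction.sq_sub_le_integral (φ : 𝓓(Ω, ℝ)) (x y : EuclideanSpace ℝ (Fin d)) :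
    (φ x - φ (x + y)) ^ 2 ≤
      ∫ t in Set.Ioc (0 : ℝ) 1, ‖y‖ ^ 2 * ‖gradient φ (x + t • y)‖ ^ 2 := by
  have hc : Continuous fun t : ℝ => fderiv ℝ φ (x + t • y) y :=
    (φ.continuous_fderiv_apply y).comp (by fun_prop)
  have hderiv : ∀ t ∈ Set.uIcc (0 : ℝ) 1,
      HasDerivAt (fun t : ℝ => φ (x + t • y)) (fderiv ℝ φ (x + t • y) y) t := by
    intro t _
    have h1 : HasDerivAt (fun t : ℝ => x + t • y) y t := by
      simpa using ((hasDerivAt_id t).smul_const y).const_add x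
    exact (φ.differentiable (x + t • y)).hasFDerivAt.comp_hasDerivAt t h1
  have hft := intervalIntegral.integral_eq_sub_of_hasDerivAt hderiv (hc.intervalIntegrable _ _)
  rw [intervalIntegral.integral_of_le zero_le_one] at hft
  simp only [one_smul, zero_smul, add_zero] at hft
  have hmem : MemLp (fun t : ℝ => fderiv ℝ φ (x + t • y) y) 2
      (volume.restrict (Set.Ioc (0 : ℝ) 1)) := by
    obtain ⟨C, hC⟩ := (isCompact_Icc (a := (0 : ℝ)) (b := 1)).exists_bound_of_continuousOn
      hc.continuousOn
    refine MemLp.of_bound hc.aestronglyMeasurable C ?_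
    filter_upwards [ae_restrict_mem measurableSet_Ioc] with t ht
    exact hC t (Set.Ioc_subset_Icc_self ht)
  have h := sq_integral_le_measureReal_mul hmem
  rw [hft] at h
  have hone : (volume.restrict (Set.Ioc (0 : ℝ) 1)).real Set.univ = 1 := by simp [measureReal_def]
  rw [hone, one_mul] at h
  calc (φ x - φ (x + y)) ^ 2 = (φ (x + y) - φ x) ^ 2 := by ring
    _ ≤ _ := h
    _ ≤ _ := by
      refine integral_mono hmem.integrable_sq ?_ fun t => ?_
      · have hcont : Continuous fun t : ℝ => ‖y‖ ^ 2 * ‖gradient φ (x + t • y)‖ ^ 2 :=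
          continuous_const.mul (((φ.continuous_gradient.comp (by fun_prop)).norm).pow 2)
        exact (hcont.integrableOn_Icc (a := 0) (b := 1)).mono_set Set.Ioc_subset_Icc_self
      · simp only
        rw [← inner_gradient_left, ← mul_pow, mul_comm, ← sq_abs]
        gcongr
        exact abs_real_inner_le_norm _ _

theorem TestFunction.lintegral_sq_sub_translate_le (φ : 𝓓(Ω, ℝ))
    (y : EuclideanSpace ℝ (Fin d)) :
    ∫⁻ x, ENNReal.ofReal ((φ x - φ (x + y)) ^ 2) ≤
      ENNReal.ofReal (‖y‖ ^ 2) * ∫⁻ x, ENNReal.ofReal (‖gradient φ x‖ ^ 2) := by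
  have hcont : Continuous fun p : EuclideanSpace ℝ (Fin d) × ℝ =>
      ‖y‖ ^ 2 * ‖gradient φ (p.1 + p.2 • y)‖ ^ 2 :=
    continuous_const.mul (((φ.continuous_gradient.comp (by fun_prop)).norm).pow 2)
  calc ∫⁻ x, ENNReal.ofReal ((φ x - φ (x + y)) ^ 2)
      ≤ ∫⁻ x, ∫⁻ t in Set.Ioc (0 : ℝ) 1,
          ENNReal.ofReal (‖y‖ ^ 2 * ‖gradient φ (x + t • y)‖ ^ 2) := by
        refine lintegral_mono fun x => ?_
        rw [← ofReal_integral_eq_lintegral_ofReal]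
        · exact ENNReal.ofReal_le_ofReal (φ.sq_sub_le_integral x y)
        · have hc : Continuous fun t : ℝ => ‖y‖ ^ 2 * ‖gradient φ (x + t • y)‖ ^ 2 :=
            continuous_const.mul (((φ.continuous_gradient.comp (by fun_prop)).norm).pow 2)
          exact (hc.integrableOn_Icc (a := 0) (b := 1)).mono_set Set.Ioc_subset_Icc_self
        · exact ae_of_all _ fun t => by positivity
    _ = ∫⁻ t in Set.Ioc (0 : ℝ) 1, ∫⁻ x,
          ENNReal.ofReal (‖y‖ ^ 2 * ‖gradient φ (x + t • y)‖ ^ 2) :=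
        lintegral_lintegral_swap (ENNReal.continuous_ofReal.comp hcont).measurable.aemeasurable
    _ = ∫⁻ t in Set.Ioc (0 : ℝ) 1,
          ENNReal.ofReal (‖y‖ ^ 2) * ∫⁻ x, ENNReal.ofReal (‖gradient φ x‖ ^ 2) := by
        refine lintegral_congr fun t => ?_
        rw [lintegral_add_right_eq_self
          (fun x => ENNReal.ofReal (‖y‖ ^ 2 * ‖gradient φ x‖ ^ 2)) (t • y)]
        simp only [ENNReal.ofReal_mul (sq_nonneg ‖y‖)]
        rw [lintegral_const_mul]
        exact (ENNReal.continuous_ofReal.comp (φ.continuous_gradient.norm.pow 2)).measurable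
    _ = _ := by simp

end Translation

section Grid

variable {d : ℕ}

/-- The index of the cell of the cubic grid of mesh size `h` that contains `x`. -/
def gridIndex (h : ℝ) (x : EuclideanSpace ℝ (Fin d)) : Fin d → ℤ := fun i => ⌊x i / h⌋

/-- The half open cells of the cubic grid of mesh size `h`. -/
def gridCell (h : ℝ) (n : Fin d → ℤ) : Set (EuclideanSpace ℝ (Fin d)) :=
  WithLp.ofLp ⁻¹' Set.pi Set.univ fun i => Set.Ico (n i * h) ((n i + 1) * h)

theorem mem_gridCell_iff {h : ℝ} (hh : 0 < h) {n : Fin d → ℤ} {x : EuclideanSpace ℝ (Fin d)} :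
    x ∈ gridCell h n ↔ gridIndex h x = n := by
  simp only [gridCell, gridIndex, Set.mem_preimage, Set.mem_pi, Set.mem_univ, true_imp_iff,
    Set.mem_Ico, funext_iff, Int.floor_eq_iff, le_div_iff₀ hh, div_lt_iff₀ hh]

theorem measurableSet_gridCell (h : ℝ) (n : Fin d → ℤ) : MeasurableSet (gridCell h n) :=
  (MeasurableSet.univ_pi fun _ => measurableSet_Ico).preimage (by fun_prop)

theorem volume_gridCell {h : ℝ} (n : Fin d → ℤ) :
    volume (gridCell h n) = ENNReal.ofReal h ^ d := by
  rw [gridCell, (PiLp.volume_preserving_ofLp (Fin d)).measure_preimage (MeasurableSet.univ_pi fun _ =>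
      measurableSet_Ico).nullMeasurableSet, volume_pi_pi]
  simp [add_mul]

/-- The closed cube of side length `2h` centred at the origin. -/
def centredCube (d : ℕ) (h : ℝ) : Set (EuclideanSpace ℝ (Fin d)) :=
  WithLp.ofLp ⁻¹' Set.pi Set.univ fun _ => Set.Icc (-h) h

theorem measurableSet_centredCube (h : ℝ) : MeasurableSet (centredCube d h) :=
  (MeasurableSet.univ_pi fun _ => measurableSet_Icc).preimage (by fun_prop)

theorem volume_centredCube {h : ℝ} :
    volume (centredCube d h) = ENNReal.ofReal (2 * h) ^ d := by
  rw [centredCube, (PiLp.volume_preserving_ofLp (Fin d)).measure_preimage (MeasurableSet.univ_pi fun _ =>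
      measurableSet_Icc).nullMeasurableSet, volume_pi_pi]
  simp [two_mul]

theorem norm_sq_le_of_mem_centredCube {h : ℝ} {x : EuclideanSpace ℝ (Fin d)}
    (hx : x ∈ centredCube d h) : ‖x‖ ^ 2 ≤ d * h ^ 2 := by
  rw [EuclideanSpace.norm_sq_eq]
  calc ∑ i, ‖x i‖ ^ 2 ≤ ∑ _i : Fin d, h ^ 2 := by
        refine Finset.sum_le_sum fun i _ => ?_
        have := hx i (Set.mem_univ i)
        gcongr
        exact abs_le.2 this
    _ = d * h ^ 2 := by simp

theorem sub_mem_centredCube {h : ℝ} {n : Fin d → ℤ} {x y : EuclideanSpace ℝ (Fin d)}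
    (hx : x ∈ gridCell h n) (hy : y ∈ gridCell h n) : y - x ∈ centredCube d h := by
  intro i _
  have h1 := hx i (Set.mem_univ i)
  have h2 := hy i (Set.mem_univ i)
  simp only [Set.mem_Ico, WithLp.ofLp_sub, Pi.sub_apply, Set.mem_Icc] at *
  constructor <;> linarith

theorem finite_gridIndex_image {h : ℝ} (hh : 0 < h) {s : Set (EuclideanSpace ℝ (Fin d))}
    (hs : Bornology.IsBounded s) : (Set.image (gridIndex h) s).Finite := by
  obtain ⟨C, hC⟩ := hs.exists_norm_le
  refine (Set.finite_Icc (fun _ => -(⌈C / h⌉ + 1) : Fin d → ℤ) (fun _ => ⌈C / h⌉ + 1)).subset ?_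
  rintro _ ⟨x, hx, rfl⟩
  have key : ∀ i, |x i / h| ≤ C / h := fun i => by
    rw [abs_div, abs_of_pos hh]
    gcongr
    exact (PiLp.norm_apply_le x i).trans (hC x hx)
  constructor <;> intro i
  · have h1 := (abs_le.1 (key i)).1
    refine Int.le_floor.2 ?_
    push_cast
    linarith [Int.le_ceil (C / h)]
  · have h1 := (abs_le.1 (key i)).2
    refine (Int.floor_le_ceil _).trans ((Int.ceil_mono h1).trans ?_)
    exact (lt_add_one _).le

end Grid

end

noncomputable section

open scoped ENNReal

section Rellich

variable {d : ℕ} {Ω : Opens (EuclideanSpace ℝ (Fin d))}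

theorem TestFunction.ofReal_sq_sub_average_le (φ : 𝓓(Ω, ℝ)) {h : ℝ} (hh : 0 < h)
    (x : EuclideanSpace ℝ (Fin d)) :
    ENNReal.ofReal ((φ x - (h ^ d)⁻¹ * ∫ y in gridCell h (gridIndex h x), φ y) ^ 2) ≤
      ENNReal.ofReal (h ^ d)⁻¹ *
        ∫⁻ z in centredCube d h, ENNReal.ofReal ((φ x - φ (x + z)) ^ 2) := by
  set Q := gridCell h (gridIndex h x) with hQ
  have hxQ : x ∈ Q := (mem_gridCell_iff hh).2 rfl
  have hm : 0 < h ^ d := by positivity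
  have hvol : volume Q = ENNReal.ofReal (h ^ d) := by
    rw [hQ, volume_gridCell, ENNReal.ofReal_pow hh.le]
  have hreal : (volume.restrict Q).real Set.univ = h ^ d := by
    rw [measureReal_def, Measure.restrict_apply_univ, hvol, ENNReal.toReal_ofReal hm.le]
  have : IsFiniteMeasure (volume.restrict Q) :=
    ⟨by rw [Measure.restrict_apply_univ, hvol]; exact ENNReal.ofReal_lt_top⟩
  have hmem : MemLp (fun y => φ x - φ y) 2 (volume.restrict Q) :=
    (memLp_const _).sub (φ.continuous.memLp_of_hasCompactSupport φ.hasCompactSupport)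
  have hint : Integrable φ (volume.restrict Q) :=
    φ.continuous.integrable_of_hasCompactSupport φ.hasCompactSupport
  have hbar : φ x - (h ^ d)⁻¹ * ∫ y in Q, φ y = (h ^ d)⁻¹ * ∫ y in Q, (φ x - φ y) := by
    rw [integral_sub (integrable_const _) hint, integral_const, hreal, smul_eq_mul]
    field_simp
  have hsq := sq_integral_le_measureReal_mul hmem
  rw [hreal] at hsq
  have h1 : (φ x - (h ^ d)⁻¹ * ∫ y in Q, φ y) ^ 2 ≤ (h ^ d)⁻¹ * ∫ y in Q, (φ x - φ y) ^ 2 := by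
    rw [hbar, mul_pow]
    calc ((h ^ d)⁻¹) ^ 2 * (∫ y in Q, (φ x - φ y)) ^ 2
        ≤ ((h ^ d)⁻¹) ^ 2 * (h ^ d * ∫ y in Q, (φ x - φ y) ^ 2) := by gcongr
      _ = (h ^ d)⁻¹ * ∫ y in Q, (φ x - φ y) ^ 2 := by field_simp
  refine (ENNReal.ofReal_le_ofReal h1).trans ?_
  rw [ENNReal.ofReal_mul (inv_nonneg.2 hm.le)]
  gcongr
  rw [ofReal_integral_eq_lintegral_ofReal hmem.integrable_sq (ae_of_all _ fun y => sq_nonneg _),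
    ← lintegral_indicator (measurableSet_gridCell h _),
    ← lintegral_indicator (measurableSet_centredCube h),
    ← lintegral_add_left_eq_self _ x]
  refine lintegral_mono fun z => ?_
  by_cases hz : x + z ∈ Q
  · have hz' : z ∈ centredCube d h := by simpa using sub_mem_centredCube hxQ hz
    rw [Set.indicator_of_mem hz, Set.indicator_of_mem hz']
  · rw [Set.indicator_of_notMem hz]
    exact zero_le

theorem TestFunction.lintegral_sq_sub_average_le (φ : 𝓓(Ω, ℝ)) {h : ℝ} (hh : 0 < h) :
    ∫⁻ x, ENNReal.ofReal ((φ x - (h ^ d)⁻¹ * ∫ y in gridCell h (gridIndex h x), φ y) ^ 2) ≤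
      ENNReal.ofReal (2 ^ d * (d * h ^ 2)) * ∫⁻ x, ENNReal.ofReal (‖gradient φ x‖ ^ 2) := by
  set G := ∫⁻ x, ENNReal.ofReal (‖gradient φ x‖ ^ 2)
  have hcont : Continuous fun p : EuclideanSpace ℝ (Fin d) × EuclideanSpace ℝ (Fin d) =>
      (φ p.1 - φ (p.1 + p.2)) ^ 2 :=
    ((φ.continuous.comp continuous_fst).sub
      (φ.continuous.comp (continuous_fst.add continuous_snd))).pow 2
  calc ∫⁻ x, ENNReal.ofReal ((φ x - (h ^ d)⁻¹ * ∫ y in gridCell h (gridIndex h x), φ y) ^ 2)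
      ≤ ∫⁻ x, ENNReal.ofReal (h ^ d)⁻¹ *
        ∫⁻ z in centredCube d h, ENNReal.ofReal ((φ x - φ (x + z)) ^ 2) :=
        lintegral_mono fun x => φ.ofReal_sq_sub_average_le hh x
    _ = ENNReal.ofReal (h ^ d)⁻¹ *
        ∫⁻ x, ∫⁻ z in centredCube d h, ENNReal.ofReal ((φ x - φ (x + z)) ^ 2) :=
        lintegral_const_mul' _ _ ENNReal.ofReal_ne_top
    _ = ENNReal.ofReal (h ^ d)⁻¹ *
        ∫⁻ z in centredCube d h, ∫⁻ x, ENNReal.ofReal ((φ x - φ (x + z)) ^ 2) := by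
        rw [lintegral_lintegral_swap (f := fun x z => ENNReal.ofReal ((φ x - φ (x + z)) ^ 2))]
        exact (ENNReal.continuous_ofReal.comp hcont).measurable.aemeasurable
    _ ≤ ENNReal.ofReal (h ^ d)⁻¹ *
        ∫⁻ _z in centredCube d h, ENNReal.ofReal (d * h ^ 2) * G := by
        refine mul_le_mul_right (setLIntegral_mono measurable_const fun z hz => ?_) _
        refine (φ.lintegral_sq_sub_translate_le z).trans ?_
        exact mul_le_mul_left (ENNReal.ofReal_le_ofReal (norm_sq_le_of_mem_centredCube hz)) _
    _ = ENNReal.ofReal (2 ^ d * (d * h ^ 2)) * G := by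
        rw [setLIntegral_const, volume_centredCube, ← ENNReal.ofReal_pow (by positivity),
          mul_right_comm _ G, ← mul_assoc, ← ENNReal.ofReal_mul (by positivity),
          ← ENNReal.ofReal_mul (by positivity)]
        congr 2
        rw [mul_pow]
        field_simp

/-- The indicator function of a grid cell. -/
def gridIndicator (Ω : Opens (EuclideanSpace ℝ (Fin d))) (h : ℝ) (n : Fin d → ℤ) : L2 Ω :=
  indicatorConstLp 2 (measurableSet_gridCell h n)
    (ne_top_of_le_ne_top (by rw [volume_gridCell]; exact ENNReal.pow_ne_top ENNReal.ofReal_ne_top)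
      (Measure.restrict_apply_le (Ω : Set (EuclideanSpace ℝ (Fin d))) (gridCell h n))) (1 : ℝ)

/-- The operator that replaces a function by its averages over the grid cells in a finite set. -/
def gridAverage (Ω : Opens (EuclideanSpace ℝ (Fin d))) (h : ℝ) (S : Finset (Fin d → ℤ)) :
    L2 Ω →L[ℝ] L2 Ω :=
  ∑ n ∈ S, ((h ^ d)⁻¹ • innerSL ℝ (gridIndicator Ω h n)).smulRight (gridIndicator Ω h n)

theorem isCompactOperator_gridAverage (h : ℝ) (S : Finset (Fin d → ℤ)) :
    IsCompactOperator (gridAverage Ω h S) := by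
  have : gridAverage Ω h S ∈ compactOperator (RingHom.id ℝ) (L2 Ω) (L2 Ω) := by
    refine Submodule.sum_mem _ fun n _ => ?_
    have h1 : IsCompactOperator ((h ^ d)⁻¹ • innerSL ℝ (gridIndicator Ω h n) : L2 Ω →L[ℝ] ℝ) :=
      isCompactOperator_of_locallyCompactSpace_dom _
    exact h1.clm_comp (ContinuousLinearMap.toSpanSingleton ℝ (gridIndicator Ω h n))
  exact this

theorem TestFunction.coeFn_gridAverage_toPair (φ : 𝓓(Ω, ℝ)) {h : ℝ} (hh : 0 < h)
    {S : Finset (Fin d → ℤ)} (hS : ∀ x ∈ Ω, gridIndex h x ∈ S) :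
    gridAverage Ω h S φ.toPair.fst =ᵐ[volume.restrict (Ω : Set (EuclideanSpace ℝ (Fin d)))]
      fun x => (h ^ d)⁻¹ * ∫ y in gridCell h (gridIndex h x), φ y := by
  have hinner : ∀ n, inner ℝ (gridIndicator Ω h n) φ.toPair.fst = ∫ y in gridCell h n, φ y := by
    intro n
    rw [gridIndicator, L2.inner_indicatorConstLp_one]
    rw [Measure.restrict_restrict (measurableSet_gridCell h n), Set.inter_comm,
      ← Measure.restrict_restrict Ω.isOpen.measurableSet]
    have h1 : ∫ y in (Ω : Set (EuclideanSpace ℝ (Fin d))), φ.toPair.fst y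
        ∂(volume.restrict (gridCell h n)) =
        ∫ y in (Ω : Set (EuclideanSpace ℝ (Fin d))), φ y ∂(volume.restrict (gridCell h n)) := by
      refine integral_congr_ae ?_
      rw [Measure.restrict_restrict Ω.isOpen.measurableSet]
      exact ae_restrict_of_ae_restrict_of_subset Set.inter_subset_left φ.coeFn_toPair_fst
    rw [h1]
    exact setIntegral_eq_integral_of_forall_compl_eq_zero fun x hx =>
      Function.notMem_support.1 fun h => hx (φ.support_subset h)
  have happ : gridAverage Ω h S φ.toPair.fst =
      ∑ n ∈ S, ((h ^ d)⁻¹ * ∫ y in gridCell h n, φ y) • gridIndicator Ω h n := by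
    simp [gridAverage, hinner]
  rw [happ]
  have hind : ∀ᵐ x ∂(volume.restrict (Ω : Set (EuclideanSpace ℝ (Fin d)))), ∀ n,
      gridIndicator Ω h n x = (gridCell h n).indicator (fun _ => (1 : ℝ)) x :=
    ae_all_iff.2 fun n => indicatorConstLp_coeFn
  have hsmul : ∀ᵐ x ∂(volume.restrict (Ω : Set (EuclideanSpace ℝ (Fin d)))), ∀ n,
      (((h ^ d)⁻¹ * ∫ y in gridCell h n, φ y) • gridIndicator Ω h n : L2 Ω) x =
        ((h ^ d)⁻¹ * ∫ y in gridCell h n, φ y) * gridIndicator Ω h n x :=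
    ae_all_iff.2 fun n => Lp.coeFn_smul _ _
  filter_upwards [hind, hsmul, ae_restrict_mem Ω.isOpen.measurableSet,
    Lp.coeFn_finsetSum S
      (fun n => ((h ^ d)⁻¹ * ∫ y in gridCell h n, φ y) • gridIndicator Ω h n)] with x h1 h2 h3 h4
  rw [h4, Finset.sum_apply, Finset.sum_eq_single (gridIndex h x)]
  · rw [h2, h1, Set.indicator_of_mem ((mem_gridCell_iff hh).2 rfl), mul_one]
  · intro n _ hn
    rw [h2, h1, Set.indicator_of_notMem (fun hx => hn ((mem_gridCell_iff hh).1 hx).symm), mul_zero]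
  · exact fun hn => absurd (hS x h3) hn

theorem TestFunction.norm_sq_sub_gridAverage_le (φ : 𝓓(Ω, ℝ)) {h : ℝ} (hh : 0 < h)
    {S : Finset (Fin d → ℤ)} (hS : ∀ x ∈ Ω, gridIndex h x ∈ S) :
    ‖φ.toPair.fst - gridAverage Ω h S φ.toPair.fst‖ ^ 2 ≤
      2 ^ d * (d * h ^ 2) * ‖φ.toPair.snd‖ ^ 2 := by
  have e1 : ENNReal.ofReal (‖φ.toPair.fst - gridAverage Ω h S φ.toPair.fst‖ ^ 2) ≤
      ∫⁻ x, ENNReal.ofReal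
        ((φ x - (h ^ d)⁻¹ * ∫ y in gridCell h (gridIndex h x), φ y) ^ 2) := by
    rw [← real_inner_self_eq_norm_sq, L2.inner_def, ofReal_integral_eq_lintegral_ofReal
      (L2.integrable_inner _ _) (ae_of_all _ fun y => real_inner_self_nonneg)]
    refine le_trans (le_of_eq (lintegral_congr_ae ?_)) 
      (setLIntegral_le_lintegral (Ω : Set (EuclideanSpace ℝ (Fin d))) _)
    filter_upwards [Lp.coeFn_sub φ.toPair.fst (gridAverage Ω h S φ.toPair.fst),
      φ.coeFn_gridAverage_toPair hh hS, φ.coeFn_toPair_fst] with x h1 h2 h3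
    rw [h1, Pi.sub_apply, h2, h3, real_inner_self_eq_norm_sq, Real.norm_eq_abs, sq_abs]
  have e2 : ∫⁻ x, ENNReal.ofReal (‖gradient φ x‖ ^ 2) = ENNReal.ofReal (‖φ.toPair.snd‖ ^ 2) := by
    rw [← real_inner_self_eq_norm_sq, L2.inner_def, ofReal_integral_eq_lintegral_ofReal
      (L2.integrable_inner _ _) (ae_of_all _ fun y => real_inner_self_nonneg)]
    rw [← setLIntegral_eq_of_support_subset (s := (Ω : Set (EuclideanSpace ℝ (Fin d))))]
    · refine lintegral_congr_ae ?_
      filter_upwards [φ.coeFn_toPair_snd] with x hx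
      rw [hx, real_inner_self_eq_norm_sq]
    · refine Function.support_subset_iff'.2 fun x hx => ?_
      have : gradient φ x = 0 := image_eq_zero_of_notMem_tsupport fun h =>
        hx (φ.tsupport_subset (φ.tsupport_gradient_subset h))
      simp [this]
  have := e1.trans (φ.lintegral_sq_sub_average_le hh)
  rw [e2, ← ENNReal.ofReal_mul (by positivity)] at this
  exact (ENNReal.ofReal_le_ofReal_iff (by positivity)).1 this

variable (Ω) in
/-- The inclusion of `H¹₀` into `L²`. -/
def H10.toL2 : H10 Ω →L[ℝ] L2 Ω :=
  WithLp.fstL 2 ℝ (L2 Ω) (L2Vec Ω) ∘L (H10 Ω).subtypeL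

theorem H10.toL2_apply (u : H10 Ω) : H10.toL2 Ω u = (u : L2Pair Ω).fst := rfl

theorem H10.norm_sub_gridAverage_le {h : ℝ} (hh : 0 < h)
    {S : Finset (Fin d → ℤ)} (hS : ∀ x ∈ Ω, gridIndex h x ∈ S) :
    ‖gridAverage Ω h S ∘L H10.toL2 Ω - H10.toL2 Ω‖ ≤ √(2 ^ d * d) * h := by
  refine ContinuousLinearMap.opNorm_le_bound _ (by positivity) fun u => ?_
  have key : ‖(u : L2Pair Ω).fst - gridAverage Ω h S (u : L2Pair Ω).fst‖ ^ 2 ≤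
      2 ^ d * (d * h ^ 2) * ‖(u : L2Pair Ω).snd‖ ^ 2 := by
    refine H10_induction (P := fun u : L2Pair Ω => ‖u.fst - gridAverage Ω h S u.fst‖ ^ 2 ≤
      2 ^ d * (d * h ^ 2) * ‖u.snd‖ ^ 2) ?_ (fun φ => φ.norm_sq_sub_gridAverage_le hh hS) u.2
    have c1 : Continuous fun p : L2Pair Ω => p.fst :=
      (WithLp.fstL 2 ℝ (L2 Ω) (L2Vec Ω)).continuous
    have c2 : Continuous fun p : L2Pair Ω => p.snd :=
      (WithLp.sndL 2 ℝ (L2 Ω) (L2Vec Ω)).continuous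
    exact isClosed_le ((c1.sub ((gridAverage Ω h S).continuous.comp c1)).norm.pow 2)
      (continuous_const.mul (c2.norm.pow 2))
  have hsnd : ‖(u : L2Pair Ω).snd‖ ^ 2 ≤ ‖u‖ ^ 2 := by
    have := WithLp.prod_norm_sq_eq_of_L2 (u : L2Pair Ω)
    rw [Submodule.coe_norm, this]
    nlinarith [sq_nonneg ‖(u : L2Pair Ω).fst‖]
  refine le_of_sq_le_sq ?_ (by positivity)
  rw [mul_pow, mul_pow, Real.sq_sqrt (by positivity)]
  calc ‖(gridAverage Ω h S ∘L H10.toL2 Ω - H10.toL2 Ω) u‖ ^ 2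
      = ‖(u : L2Pair Ω).fst - gridAverage Ω h S (u : L2Pair Ω).fst‖ ^ 2 := by
        rw [norm_sub_rev]; rfl
    _ ≤ 2 ^ d * (d * h ^ 2) * ‖(u : L2Pair Ω).snd‖ ^ 2 := key
    _ ≤ 2 ^ d * (d * h ^ 2) * ‖u‖ ^ 2 := by gcongr
    _ = _ := by ring

/-- **Rellich theorem**: the inclusion of `H¹₀(Ω)` into `L²(Ω)` is compact if `Ω` is bounded. -/
theorem H10.isCompactOperator_toL2
    (hbdd : Bornology.IsBounded (Ω : Set (EuclideanSpace ℝ (Fin d)))) :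
    IsCompactOperator (H10.toL2 Ω) := by
  have hpos : ∀ n : ℕ, (0 : ℝ) < 1 / ((n : ℝ) + 1) := fun n => Nat.one_div_pos_of_nat
  let S : ℕ → Finset (Fin d → ℤ) := fun n => (finite_gridIndex_image (hpos n) hbdd).toFinset
  have hS : ∀ n, ∀ x ∈ Ω, gridIndex (1 / ((n : ℝ) + 1)) x ∈ S n := fun n x hx => by
    simp only [S, Set.Finite.mem_toFinset]
    exact Set.mem_image_of_mem _ hx
  refine isCompactOperator_of_tendsto (l := atTop)
    (F := fun n : ℕ => gridAverage Ω (1 / ((n : ℝ) + 1)) (S n) ∘L H10.toL2 Ω) ?_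
    (Eventually.of_forall fun n => (isCompactOperator_gridAverage _ _).comp_clm _)
  refine (tendsto_iff_norm_sub_tendsto_zero (E := H10 Ω →L[ℝ] L2 Ω)).2 ?_
  refine squeeze_zero (fun _ => ContinuousLinearMap.opNorm_nonneg _)
    (fun n => H10.norm_sub_gridAverage_le (hpos n) (hS n)) ?_
  simpa using tendsto_one_div_add_atTop_nhds_zero_nat.const_mul (√(2 ^ d * d))

end Rellich

end

noncomputable section

/-- A family of reals with finite sublevel sets can be listed in nondecreasing order. -/
theorem exists_equiv_nat_monotone {I : Type*} [Infinite I] (f : I → ℝ)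
    (hf : ∀ N : ℝ, {i | f i ≤ N}.Finite) : ∃ e : ℕ ≃ I, Monotone (f ∘ e) := by
  have hcount : Countable I := by
    have : (⋃ n : ℕ, {i | f i ≤ n}) = Set.univ :=
      Set.eq_univ_of_forall fun i => Set.mem_iUnion.2 (exists_nat_ge (f i))
    rw [← Set.countable_univ_iff, ← this]
    exact Set.countable_iUnion fun n => (hf n).countable
  obtain ⟨c, hc⟩ := hcount.exists_injective_nat
  let g : I → ℝ ×ₗ ℕ := fun i => toLex (f i, c i)
  have hg : Function.Injective g := fun i j hij => hc (congrArg (fun p => (ofLex p).2) hij)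
  let _ : LinearOrder I := LinearOrder.lift' g hg
  have hmono : ∀ i j : I, i ≤ j → f i ≤ f j := by
    intro i j hij
    have : g i ≤ g j := hij
    rcases Prod.Lex.le_iff.1 this with h | h
    · exact h.le
    · exact h.1.le
  have hfin : ∀ i : I, (Set.Iic i).Finite := fun i => (hf (f i)).subset fun j hj => hmono j i hj
  let _ : LocallyFiniteOrder I := LocallyFiniteOrder.ofFiniteIcc fun a b =>
    (hfin b).subset Set.Icc_subset_Iic_self
  have hbot : ∃ b : I, ∀ j, b ≤ j := by
    obtain ⟨i⟩ := (inferInstance : Nonempty I)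
    obtain ⟨b, hb, hmin⟩ := (hfin i).exists_minimal ⟨i, le_refl i⟩
    refine ⟨b, fun j => ?_⟩
    rcases le_total b j with h | h
    · exact h
    · exact hmin (le_trans h hb) h
  let _ : OrderBot I := { bot := hbot.choose, bot_le := hbot.choose_spec }
  have : NoMaxOrder I := by
    refine ⟨fun a => ?_⟩
    by_contra! h
    have : (Set.univ : Set I).Finite := (hfin a).subset fun j _ => h j
    exact Set.infinite_univ this
  let _ : SuccOrder I := LinearLocallyFiniteOrder.succOrder I
  let _ : PredOrder I := LinearLocallyFiniteOrder.predOrder I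
  let e : I ≃o ℕ := orderIsoNatOfLinearSuccPredArch
  exact ⟨e.symm.toEquiv, fun m n hmn => hmono _ _ (e.symm.monotone hmn)⟩

theorem exists_orthonormal_span {H : Type*} [NormedAddCommGroup H] [InnerProductSpace ℝ H]
    (E : Submodule ℝ H) [FiniteDimensional ℝ E] :
    ∃ v : Fin (Module.finrank ℝ E) → H, (∀ i, v i ∈ E) ∧ Orthonormal ℝ v ∧
      Submodule.span ℝ (Set.range v) = E := by
  let b := stdOrthonormalBasis ℝ E
  refine ⟨fun i => b i, fun i => (b i).2, b.orthonormal.comp_linearIsometry E.subtypeₗᵢ, ?_⟩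
  have h := congrArg (Submodule.map E.subtype) b.toBasis.span_eq
  rw [Submodule.map_span, ← Set.range_comp, Submodule.map_top, Submodule.range_subtype,
    b.coe_toBasis] at h
  exact h

section Spectrum

variable {d : ℕ} {Ω : Opens (EuclideanSpace ℝ (Fin d))}

instance : CompleteSpace (H10 Ω) :=
  (testGraph Ω).isClosed_topologicalClosure.completeSpace_coe

theorem H10.inner_eq (u v : H10 Ω) : inner ℝ u v =
    inner ℝ (u : L2Pair Ω).fst (v : L2Pair Ω).fst +
      inner ℝ (u : L2Pair Ω).snd (v : L2Pair Ω).snd :=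
  WithLp.prod_inner_apply _ _

theorem H10.inner_smul_left (c : ℝ) (u v : H10 Ω) : inner ℝ (c • u) v = c * inner ℝ u v := by
  simp only [H10.inner_eq, Submodule.coe_smul, WithLp.smul_fst, WithLp.smul_snd,
    real_inner_smul_left, mul_add]

variable (Ω) in
/-- The operator `T` on `H¹₀` with `⟪T u, v⟫ = ∫ u v`, where the inner product is that of `H¹`. -/
def massOperator : H10 Ω →L[ℝ] H10 Ω := (H10.toL2 Ω).adjoint ∘L H10.toL2 Ω

theorem inner_massOperator (u v : H10 Ω) :
    inner ℝ (massOperator Ω u) v = inner ℝ (u : L2Pair Ω).fst (v : L2Pair Ω).fst := by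
  rw [massOperator, ContinuousLinearMap.comp_apply, ContinuousLinearMap.adjoint_inner_left]
  rfl

theorem isSymmetric_massOperator : (massOperator Ω).IsSymmetric := by
  intro u v
  simp only [ContinuousLinearMap.coe_coe]
  exact (inner_massOperator u v).trans ((real_inner_comm _ _).trans
    ((inner_massOperator v u).symm.trans (real_inner_comm _ _)))

theorem isCompactOperator_massOperator
    (hbdd : Bornology.IsBounded (Ω : Set (EuclideanSpace ℝ (Fin d)))) :
    IsCompactOperator (massOperator Ω) :=
  (H10.isCompactOperator_toL2 hbdd).clm_comp (H10.toL2 Ω).adjoint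

theorem mem_dirichletEigenspace_iff {μ : ℝ} (hμ : -1 < μ) {u : H10 Ω} :
    u ∈ dirichletEigenspace Ω μ ↔ massOperator Ω u = (1 + μ)⁻¹ • u := by
  have hμ' : 1 + μ ≠ 0 := by linarith
  rw [← sub_eq_zero, ← inner_self_eq_zero (𝕜 := ℝ)]
  have h1 : ∀ v, inner ℝ (massOperator Ω u - (1 + μ)⁻¹ • u) v = (1 + μ)⁻¹ *
      (μ * inner ℝ (u : L2Pair Ω).fst (v : L2Pair Ω).fst -
        inner ℝ (u : L2Pair Ω).snd (v : L2Pair Ω).snd) := by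
    intro v
    rw [inner_sub_left, H10.inner_smul_left, inner_massOperator, H10.inner_eq]
    field_simp
    ring
  constructor
  · intro hu
    rw [h1, hu]
    ring
  · intro hu v
    have := h1 v
    rw [inner_self_eq_zero.1 hu, inner_zero_left, eq_comm, mul_eq_zero] at this
    rcases this with h | h
    · exact absurd h (inv_ne_zero hμ')
    · linarith

theorem norm_snd_sq_of_mem_dirichletEigenspace {μ : ℝ} {u : H10 Ω}
    (hu : u ∈ dirichletEigenspace Ω μ) :
    ‖(u : L2Pair Ω).snd‖ ^ 2 = μ * ‖(u : L2Pair Ω).fst‖ ^ 2 := by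
  simpa only [real_inner_self_eq_norm_sq] using hu u

theorem H10.eq_zero_of_snd_eq_zero (hd : 1 ≤ d)
    (hbdd : Bornology.IsBounded (Ω : Set (EuclideanSpace ℝ (Fin d)))) {u : H10 Ω}
    (hu : (u : L2Pair Ω).snd = 0) : u = 0 := by
  have h := neg_two_mul_inner_coordField_mulCoord hbdd ⟨0, hd⟩ u.2
  rw [hu, map_zero, inner_zero_left, mul_zero, eq_comm, sq_eq_zero_iff, norm_eq_zero] at h
  exact Subtype.ext (WithLp.ofLp_injective 2 (Prod.ext h hu))

theorem pos_of_mem_dirichletEigenspace (hd : 1 ≤ d)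
    (hbdd : Bornology.IsBounded (Ω : Set (EuclideanSpace ℝ (Fin d)))) {μ : ℝ} {u : H10 Ω}
    (hu : u ∈ dirichletEigenspace Ω μ) (hu0 : u ≠ 0) : 0 < μ := by
  by_contra! hμ
  refine hu0 (H10.eq_zero_of_snd_eq_zero hd hbdd ?_)
  have h := norm_snd_sq_of_mem_dirichletEigenspace hu
  rw [← norm_eq_zero, ← sq_eq_zero_iff]
  nlinarith [sq_nonneg ‖(u : L2Pair Ω).snd‖, sq_nonneg ‖(u : L2Pair Ω).fst‖]

theorem dirichletEigenspace_eq_bot (hd : 1 ≤ d)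
    (hbdd : Bornology.IsBounded (Ω : Set (EuclideanSpace ℝ (Fin d)))) {μ : ℝ} (hμ : μ ≤ 0) :
    dirichletEigenspace Ω μ = ⊥ :=
  (Submodule.eq_bot_iff _).2 fun _ hu => by_contra fun hu0 =>
    hμ.not_gt (pos_of_mem_dirichletEigenspace hd hbdd hu hu0)

theorem dirichletEigenspace_eq_eigenspace {μ : ℝ} (hμ : -1 < μ) :
    dirichletEigenspace Ω μ =
      Module.End.eigenspace (massOperator Ω : Module.End ℝ (H10 Ω)) (1 + μ)⁻¹ := by
  ext u
  rw [mem_dirichletEigenspace_iff hμ, Module.End.mem_eigenspace_iff, ContinuousLinearMap.coe_coe]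

theorem finiteDimensional_dirichletEigenspace (hd : 1 ≤ d)
    (hbdd : Bornology.IsBounded (Ω : Set (EuclideanSpace ℝ (Fin d)))) (μ : ℝ) :
    FiniteDimensional ℝ (dirichletEigenspace Ω μ) := by
  rcases le_or_gt μ 0 with hμ | hμ
  · rw [dirichletEigenspace_eq_bot hd hbdd hμ]
    infer_instance
  · rw [dirichletEigenspace_eq_eigenspace (by linarith)]
    exact (massOperator Ω).finite_dimensional_eigenspace (isCompactOperator_massOperator hbdd) _
      (inv_ne_zero (by linarith))

theorem finite_setOf_dirichletEigenspace_ne_bot (hd : 1 ≤ d)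
    (hbdd : Bornology.IsBounded (Ω : Set (EuclideanSpace ℝ (Fin d)))) (N : ℝ) :
    {μ : ℝ | μ ≤ N ∧ dirichletEigenspace Ω μ ≠ ⊥}.Finite := by
  rcases le_or_gt N 0 with hN | hN
  · convert Set.finite_empty
    refine Set.eq_empty_of_forall_notMem fun μ hμ => ?_
    exact hμ.2 (dirichletEigenspace_eq_bot hd hbdd (hμ.1.trans hN))
  have hfin := (massOperator Ω).finite_setOf_hasEigenvalue_ge (isCompactOperator_massOperator hbdd)
    isSymmetric_massOperator (t := (1 + N)⁻¹) (by positivity)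
  refine (hfin.image fun τ => τ⁻¹ - 1).subset ?_
  rintro μ ⟨hμN, hμ⟩
  have hpos : 0 < μ := by
    by_contra! h
    exact hμ (dirichletEigenspace_eq_bot hd hbdd h)
  refine ⟨(1 + μ)⁻¹, ⟨by gcongr, ?_⟩, by simp⟩
  rwa [dirichletEigenspace_eq_eigenspace (by linarith)] at hμ

variable (Ω) in
/-- An index set for the eigenvalues, counted with multiplicity. -/
abbrev EigenIndex : Type := Σ μ : ℝ, Fin (Module.finrank ℝ (dirichletEigenspace Ω μ))

theorem EigenIndex.ne_bot (i : EigenIndex Ω) : dirichletEigenspace Ω i.1 ≠ ⊥ := by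
  intro h
  have h1 := i.2.pos
  have h2 : Module.finrank ℝ (dirichletEigenspace Ω i.1) = 0 := by rw [h, finrank_bot]
  exact h1.ne' h2

theorem EigenIndex.pos (hd : 1 ≤ d)
    (hbdd : Bornology.IsBounded (Ω : Set (EuclideanSpace ℝ (Fin d)))) (i : EigenIndex Ω) :
    0 < i.1 := by
  by_contra! h
  exact EigenIndex.ne_bot i (dirichletEigenspace_eq_bot hd hbdd h)

theorem EigenIndex.finite_le (hd : 1 ≤ d)
    (hbdd : Bornology.IsBounded (Ω : Set (EuclideanSpace ℝ (Fin d)))) (N : ℝ) :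
    {i : EigenIndex Ω | i.1 ≤ N}.Finite := by
  have h := (finite_setOf_dirichletEigenspace_ne_bot hd hbdd N).biUnion
    (t := fun μ => Set.range (Sigma.mk (β := fun μ : ℝ =>
      Fin (Module.finrank ℝ (dirichletEigenspace Ω μ))) μ)) fun μ _ => Set.finite_range _
  refine h.subset fun i hi => ?_
  exact Set.mem_biUnion (show i.1 ∈ _ from ⟨hi, EigenIndex.ne_bot i⟩) ⟨i.2, rfl⟩

theorem inner_fst_eq_zero_of_ne {μ ν : ℝ} (hne : μ ≠ ν) {u v : H10 Ω}
    (hu : u ∈ dirichletEigenspace Ω μ) (hv : v ∈ dirichletEigenspace Ω ν) :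
    inner ℝ (u : L2Pair Ω).fst (v : L2Pair Ω).fst = 0 := by
  have h1 := hu v
  have h2 := hv u
  rw [real_inner_comm, real_inner_comm (u : L2Pair Ω).fst, h1] at h2
  have : (μ - ν) * inner ℝ (u : L2Pair Ω).fst (v : L2Pair Ω).fst = 0 := by linarith
  exact (mul_eq_zero.1 this).resolve_left (sub_ne_zero.2 hne)

/-- There is a family of eigenfunctions, orthonormal in `L²`, that spans all the eigenspaces. -/
theorem exists_orthonormal_eigenfunctions (hd : 1 ≤ d)
    (hbdd : Bornology.IsBounded (Ω : Set (EuclideanSpace ℝ (Fin d)))) :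
    ∃ b : EigenIndex Ω → H10 Ω, (∀ i, b i ∈ dirichletEigenspace Ω i.1) ∧
      Orthonormal ℝ (fun i => (b i : L2Pair Ω).fst) ∧
      ∀ μ, dirichletEigenspace Ω μ ≤ Submodule.span ℝ (Set.range fun j => b ⟨μ, j⟩) := by
  classical
  have hfd := finiteDimensional_dirichletEigenspace (Ω := Ω) hd hbdd
  choose v hv hvon hvspan using fun μ => exists_orthonormal_span (dirichletEigenspace Ω μ)
  let b : EigenIndex Ω → H10 Ω := fun i => √(1 + i.1) • v i.1 i.2
  have hb : ∀ i, b i ∈ dirichletEigenspace Ω i.1 := fun i =>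
    Submodule.smul_mem _ _ (hv i.1 i.2)
  refine ⟨b, hb, ?_, ?_⟩
  · rw [orthonormal_iff_ite]
    rintro ⟨μ, i⟩ ⟨ν, j⟩
    by_cases hne : μ = ν
    · subst hne
      have hμ : 0 < μ := EigenIndex.pos hd hbdd ⟨μ, i⟩
      have h1 := orthonormal_iff_ite.1 (hvon μ) i j
      rw [H10.inner_eq, hv μ i (v μ j)] at h1
      have h2 : inner ℝ (b ⟨μ, i⟩ : L2Pair Ω).fst (b ⟨μ, j⟩ : L2Pair Ω).fst =
          (1 + μ) * inner ℝ (v μ i : L2Pair Ω).fst (v μ j : L2Pair Ω).fst := by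
        simp only [b, Submodule.coe_smul, WithLp.smul_fst, real_inner_smul_left,
          real_inner_smul_right]
        rw [← mul_assoc, Real.mul_self_sqrt (by linarith)]
      rw [h2]
      simp only [Sigma.mk.injEq, heq_eq_eq, true_and]
      rw [← h1]
      ring
    · rw [if_neg (fun h => hne (congrArg Sigma.fst h))]
      exact inner_fst_eq_zero_of_ne hne (hb ⟨μ, i⟩) (hb ⟨ν, j⟩)
  · intro μ
    conv_lhs => rw [← hvspan μ]
    refine Submodule.span_le.2 ?_
    rintro _ ⟨i, rfl⟩
    have hμ : 0 < μ := EigenIndex.pos hd hbdd ⟨μ, i⟩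
    have hs : √(1 + μ) ≠ 0 := (Real.sqrt_pos.2 (by linarith)).ne'
    have : v μ i = (√(1 + μ))⁻¹ • b ⟨μ, i⟩ := by
      simp only [b, smul_smul, inv_mul_cancel₀ hs, one_smul]
    rw [this]
    exact Submodule.smul_mem _ _ (Submodule.subset_span ⟨i, rfl⟩)

/-- The min-max lower bound: a function orthogonal to the eigenfunctions for the eigenvalues below
`z` has Rayleigh quotient at least `z`. -/
theorem mul_norm_fst_sq_le_norm_snd_sq
    (hbdd : Bornology.IsBounded (Ω : Set (EuclideanSpace ℝ (Fin d)))) {z : ℝ} (hz : 0 ≤ z)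
    {w : H10 Ω} (hw : ∀ μ < z, ∀ u ∈ dirichletEigenspace Ω μ,
      inner ℝ (u : L2Pair Ω).fst (w : L2Pair Ω).fst = 0) :
    z * ‖(w : L2Pair Ω).fst‖ ^ 2 ≤ ‖(w : L2Pair Ω).snd‖ ^ 2 := by
  have h := (massOperator Ω).inner_apply_self_le_of_orthogonal
    (isCompactOperator_massOperator hbdd) isSymmetric_massOperator
    (fun x => by rw [inner_massOperator]; exact real_inner_self_nonneg)
    (t := (1 + z)⁻¹) (by positivity) (w := w) ?_
  · rw [inner_massOperator, real_inner_self_eq_norm_sq, ← real_inner_self_eq_norm_sq w,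
      H10.inner_eq, real_inner_self_eq_norm_sq, real_inner_self_eq_norm_sq] at h
    rw [inv_mul_eq_div, le_div_iff₀ (by positivity)] at h
    linarith
  · intro τ hτ u hu
    have hτ0 : 0 < τ := lt_trans (by positivity) hτ
    have hmem : u ∈ dirichletEigenspace Ω (τ⁻¹ - 1) := by
      rw [mem_dirichletEigenspace_iff (by linarith [inv_pos.2 hτ0])]
      simpa using hu
    have hlt : τ⁻¹ - 1 < z := by
      have : τ⁻¹ < 1 + z := by
        rw [inv_lt_comm₀ hτ0 (by positivity)]
        exact hτ
      linarith
    rw [H10.inner_eq, hmem w, hw _ hlt u hmem]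
    ring

/-- **The Yang inequality**. -/
theorem yang_inequality (hd : 1 ≤ d)
    (hbdd : Bornology.IsBounded (Ω : Set (EuclideanSpace ℝ (Fin d)))) {z : ℝ} (hz : 0 ≤ z)
    (s : Finset (EigenIndex Ω)) (hs : ∀ i, i ∈ s ↔ i.1 < z) :
    (d : ℝ) * ∑ i ∈ s, (z - i.1) ^ 2 ≤ 4 * ∑ i ∈ s, (z - i.1) * i.1 := by
  obtain ⟨b, hb, hon, hspan⟩ := exists_orthonormal_eigenfunctions (Ω := Ω) hd hbdd
  have hcoord : ∀ a : Fin d, ∑ i ∈ s, (z - i.1) ^ 2 ≤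
      4 * ∑ i ∈ s, (z - i.1) * ‖coordField Ω a (b i : L2Pair Ω).snd‖ ^ 2 := by
    intro a
    have hw : ∀ w : H10 Ω, (∀ i : s, inner ℝ (b i : L2Pair Ω).fst (w : L2Pair Ω).fst = (0 : ℝ)) →
        z * ‖(w : L2Pair Ω).fst‖ ^ 2 ≤ ‖(w : L2Pair Ω).snd‖ ^ 2 := by
      intro w hw
      refine mul_norm_fst_sq_le_norm_snd_sq hbdd hz fun μ hμ u hu => ?_
      refine Submodule.span_induction (p := fun (u : H10 Ω) _ =>
        inner ℝ (u : L2Pair Ω).fst (w : L2Pair Ω).fst = (0 : ℝ)) ?_ ?_ ?_ ?_ (hspan μ hu)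
      · rintro _ ⟨j, rfl⟩
        exact hw ⟨⟨μ, j⟩, (hs _).2 hμ⟩
      · simp
      · intro x y _ _ hx hy
        simp only [Submodule.coe_add, WithLp.add_fst, inner_add_left, hx, hy, add_zero]
      · intro c x _ hx
        simp only [Submodule.coe_smul, WithLp.smul_fst, real_inner_smul_left, hx, mul_zero]
    have key := yang_inequality_of_commutator (ι := s) (fun i => (i : EigenIndex Ω).1) z
      (fun i => (b i : L2Pair Ω).fst) (fun i => mulCoord hbdd a ℝ (b i : L2Pair Ω).fst)
      (fun i => coordField Ω a (b i : L2Pair Ω).snd) (fun i => (hs i).1 i.2)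
      (hon.comp _ Subtype.val_injective) ?_ ?_ ?_ ?_
    · rw [Finset.sum_coe_sort s fun i => (z - i.1) ^ 2, Finset.sum_coe_sort s
        fun i => (z - i.1) * ‖coordField Ω a (b i : L2Pair Ω).snd‖ ^ 2] at key
      exact key
    · intro i j
      rw [inner_mulCoord, real_inner_comm]
    · intro i j
      have h := inner_mulCoordPair_snd_of_mem_eigenspace hbdd a (hb i) (b j).2
      have h' := hb j ⟨_, mulCoordPair_mem_H10 hbdd a (b i).2⟩
      rw [real_inner_comm, h, mulCoordPair_fst, real_inner_comm (mulCoord _ _ _ _)] at h'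
      linarith
    · intro i
      rw [neg_two_mul_inner_coordField_mulCoord hbdd a (b i).2, hon.1 i, one_pow]
    · intro i
      set g : s → ℝ := fun j =>
        inner ℝ (mulCoord hbdd a ℝ (b i : L2Pair Ω).fst) (b j : L2Pair Ω).fst with hg
      let w : H10 Ω := ⟨mulCoordPair hbdd a (b i), mulCoordPair_mem_H10 hbdd a (b i).2⟩ -
        ∑ j : s, g j • b j
      have hw1 : (w : L2Pair Ω).fst =
          mulCoord hbdd a ℝ (b i : L2Pair Ω).fst - ∑ j : s, g j • (b j : L2Pair Ω).fst := by
        have := map_sum (H10.toL2 Ω) (fun j : s => g j • b j) Finset.univ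
        simp only [map_smul, H10.toL2_apply] at this
        rw [← this]
        rfl
      have hw2 : (w : L2Pair Ω).snd =
          (mulCoordPair hbdd a (b i)).snd - ∑ j : s, g j • (b j : L2Pair Ω).snd := by
        have := map_sum (WithLp.sndL 2 ℝ (L2 Ω) (L2Vec Ω) ∘L (H10 Ω).subtypeL)
          (fun j : s => g j • b j) Finset.univ
        simp only [map_smul] at this
        exact congrArg ((mulCoordPair hbdd a (b i)).snd - ·) this
      have horth : ∀ j : s, inner ℝ (b j : L2Pair Ω).fst (w : L2Pair Ω).fst = (0 : ℝ) := by
        classical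
        intro j
        rw [hw1, inner_sub_right, inner_sum]
        simp only [real_inner_smul_right, orthonormal_iff_ite.1 hon, Subtype.val_inj, mul_ite,
          mul_one, mul_zero, Finset.sum_ite_eq, Finset.mem_univ, if_true]
        rw [hg, real_inner_comm, sub_self]
      rw [← hw1]
      have h1 := hw w horth
      have h2 : ‖(w : L2Pair Ω).snd‖ ^ 2 = (i : EigenIndex Ω).1 * ‖(w : L2Pair Ω).fst‖ ^ 2 -
          2 * inner ℝ (coordField Ω a (b i : L2Pair Ω).snd) (w : L2Pair Ω).fst := by
        have h3 := inner_mulCoordPair_snd_of_mem_eigenspace hbdd a (hb i) w.2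
        have h4 : inner ℝ (mulCoord hbdd a ℝ (b i : L2Pair Ω).fst) (w : L2Pair Ω).fst =
            ‖(w : L2Pair Ω).fst‖ ^ 2 := by
          rw [sub_eq_iff_eq_add.1 hw1.symm, inner_add_left, sum_inner, real_inner_self_eq_norm_sq]
          simp [real_inner_smul_left, horth]
        rw [← h4, ← h3, ← real_inner_self_eq_norm_sq]
        conv_lhs => rw [hw2, inner_sub_left, ← hw2, sum_inner]
        rw [sub_eq_self]
        refine Finset.sum_eq_zero fun j _ => ?_
        rw [real_inner_smul_left, hb j w, horth, mul_zero, mul_zero]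
      linarith
  have hnorm : ∀ i, ∑ a, ‖coordField Ω a (b i : L2Pair Ω).snd‖ ^ 2 = i.1 := by
    intro i
    rw [← norm_sq_eq_sum_coordField, norm_snd_sq_of_mem_dirichletEigenspace (hb i), hon.1 i]
    ring
  have hsum := Finset.sum_le_sum fun a (_ : a ∈ (Finset.univ : Finset (Fin d))) => hcoord a
  rw [Finset.sum_const, Finset.card_univ, Fintype.card_fin, nsmul_eq_mul, ← Finset.mul_sum,
    Finset.sum_comm] at hsum
  simpa only [← Finset.mul_sum, hnorm] using hsum

end Spectrum

end

noncomputable section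

section Existence

variable {d : ℕ} {Ω : Opens (EuclideanSpace ℝ (Fin d))}

theorem TestFunction.exists_toPair_fst_ne_zero
    (hne : (Ω : Set (EuclideanSpace ℝ (Fin d))).Nonempty) :
    ∃ φ : 𝓓(Ω, ℝ), φ.toPair.fst ≠ 0 := by
  obtain ⟨x, hx⟩ := hne
  obtain ⟨f, hsupp, hcomp, hsmooth, -, hfx⟩ :=
    exists_contDiff_tsupport_subset (n := ⊤) (Ω.isOpen.mem_nhds hx)
  let φ : 𝓓(Ω, ℝ) := ⟨f, hsmooth, hcomp, hsupp⟩
  refine ⟨φ, fun h0 => ?_⟩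
  have hae : φ =ᵐ[volume.restrict (Ω : Set (EuclideanSpace ℝ (Fin d)))] fun _ => (0 : ℝ) := by
    refine φ.coeFn_toPair_fst.symm.trans ?_
    rw [h0]
    exact Lp.coeFn_zero _ _ _
  have := Measure.eqOn_open_of_ae_eq hae Ω.isOpen φ.continuous.continuousOn continuousOn_const hx
  exact one_ne_zero (hfx.symm.trans this)

theorem nonempty_eigenIndex (hbdd : Bornology.IsBounded (Ω : Set (EuclideanSpace ℝ (Fin d))))
    (hd : 1 ≤ d) (hne : (Ω : Set (EuclideanSpace ℝ (Fin d))).Nonempty) :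
    Nonempty (EigenIndex Ω) := by
  by_contra hempty
  have hfd := finiteDimensional_dirichletEigenspace (Ω := Ω) hd hbdd
  have hbot : ∀ μ, dirichletEigenspace Ω μ = ⊥ := by
    intro μ
    rw [← Submodule.finrank_eq_zero (R := ℝ)]
    by_contra h
    exact hempty ⟨⟨μ, ⟨0, Nat.pos_of_ne_zero h⟩⟩⟩
  obtain ⟨φ, hφ⟩ := TestFunction.exists_toPair_fst_ne_zero hne
  let w : H10 Ω := ⟨φ.toPair, φ.toPair_mem_H10⟩
  have key : ∀ z : ℝ, 0 ≤ z → z * ‖φ.toPair.fst‖ ^ 2 ≤ ‖φ.toPair.snd‖ ^ 2 := fun z hz =>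
    mul_norm_fst_sq_le_norm_snd_sq hbdd hz (w := w) fun μ _ u hu => by
      rw [hbot μ, Submodule.mem_bot] at hu
      simp [hu]
  have hpos : 0 < ‖φ.toPair.fst‖ ^ 2 := by positivity
  have := key ((‖φ.toPair.snd‖ ^ 2 + 1) / ‖φ.toPair.fst‖ ^ 2) (by positivity)
  rw [div_mul_cancel₀ _ hpos.ne'] at this
  linarith

theorem infinite_eigenIndex (hbdd : Bornology.IsBounded (Ω : Set (EuclideanSpace ℝ (Fin d))))
    (hd : 1 ≤ d) (hne : (Ω : Set (EuclideanSpace ℝ (Fin d))).Nonempty) :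
    Infinite (EigenIndex Ω) := by
  by_contra hfin
  rw [not_infinite_iff_finite] at hfin
  have := Fintype.ofFinite (EigenIndex Ω)
  have hnon := nonempty_eigenIndex hbdd hd hne
  have hpos := EigenIndex.pos (Ω := Ω) hd hbdd
  set M := ∑ i : EigenIndex Ω, i.1
  have hM : ∀ i : EigenIndex Ω, i.1 ≤ M := fun i =>
    Finset.single_le_sum (f := fun i : EigenIndex Ω => i.1) (fun j _ => (hpos j).le)
      (Finset.mem_univ i)
  have hM0 : 0 < M := (hpos hnon.some).trans_le (hM _)
  have hy := yang_inequality hd hbdd (z := 6 * M) (by positivity) Finset.univ fun i =>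
    ⟨fun _ => by linarith [hM i], fun _ => Finset.mem_univ i⟩
  have hlt : 4 * ∑ i : EigenIndex Ω, (6 * M - i.1) * i.1 <
      ∑ i : EigenIndex Ω, (6 * M - i.1) ^ 2 := by
    rw [Finset.mul_sum]
    refine Finset.sum_lt_sum_of_nonempty Finset.univ_nonempty fun i _ => ?_
    nlinarith [hM i, hpos i]
  have hd' : (1 : ℝ) ≤ d := by exact_mod_cast hd
  have hnn : 0 ≤ ∑ i : EigenIndex Ω, (6 * M - i.1) ^ 2 := Finset.sum_nonneg fun i _ => sq_nonneg _
  nlinarith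

theorem mk_fin_finrank_dirichletEigenspace (hd : 1 ≤ d)
    (hbdd : Bornology.IsBounded (Ω : Set (EuclideanSpace ℝ (Fin d)))) (μ : ℝ) :
    Cardinal.mk (Fin (Module.finrank ℝ (dirichletEigenspace Ω μ))) =
      Module.rank ℝ (dirichletEigenspace Ω μ) := by
  have := finiteDimensional_dirichletEigenspace (Ω := Ω) hd hbdd μ
  rw [Cardinal.mk_fin, Module.finrank_eq_rank]

theorem exists_isDirichletSpectrum (hd : 1 ≤ d)
    (hne : (Ω : Set (EuclideanSpace ℝ (Fin d))).Nonempty)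
    (hbdd : Bornology.IsBounded (Ω : Set (EuclideanSpace ℝ (Fin d)))) :
    ∃ lam : ℕ → ℝ, IsDirichletSpectrum Ω lam := by
  have := infinite_eigenIndex hbdd hd hne
  obtain ⟨e, he⟩ := exists_equiv_nat_monotone (fun i : EigenIndex Ω => i.1)
    (EigenIndex.finite_le hd hbdd)
  refine ⟨fun k => (e k).1, he, fun μ => ?_⟩
  rw [← mk_fin_finrank_dirichletEigenspace hd hbdd, Cardinal.eq]
  let g : Fin (Module.finrank ℝ (dirichletEigenspace Ω μ)) → {i : EigenIndex Ω // i.1 = μ} :=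
    fun j => ⟨⟨μ, j⟩, rfl⟩
  have hg : Function.Bijective g := by
    refine ⟨fun j j' h => ?_, ?_⟩
    · exact eq_of_heq (Sigma.mk.inj (congrArg Subtype.val h)).2
    · rintro ⟨⟨ν, j⟩, rfl⟩
      exact ⟨j, rfl⟩
  exact ⟨(e.subtypeEquiv fun k => Iff.rfl).trans (Equiv.ofBijective g hg).symm⟩

theorem IsDirichletSpectrum.exists_equiv (hd : 1 ≤ d)
    (hbdd : Bornology.IsBounded (Ω : Set (EuclideanSpace ℝ (Fin d)))) {lam : ℕ → ℝ}
    (hlam : IsDirichletSpectrum Ω lam) : ∃ e : ℕ ≃ EigenIndex Ω, ∀ k, (e k).1 = lam k := by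
  have h : ∀ μ, Nonempty ({k // lam k = μ} ≃
      Fin (Module.finrank ℝ (dirichletEigenspace Ω μ))) := fun μ => by
    rw [← Cardinal.eq, mk_fin_finrank_dirichletEigenspace hd hbdd, hlam.multiplicity]
  exact ⟨(Equiv.sigmaFiberEquiv lam).symm.trans (Equiv.sigmaCongrRight fun μ => (h μ).some),
    fun k => rfl⟩

end Existence

section Consequences

variable {d : ℕ} {Ω : Opens (EuclideanSpace ℝ (Fin d))} {lam : ℕ → ℝ}

theorem IsDirichletSpectrum.pos (hlam : IsDirichletSpectrum Ω lam) (hd : 1 ≤ d)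
    (hbdd : Bornology.IsBounded (Ω : Set (EuclideanSpace ℝ (Fin d)))) (k : ℕ) : 0 < lam k := by
  obtain ⟨e, he⟩ := hlam.exists_equiv hd hbdd
  rw [← he]
  exact EigenIndex.pos hd hbdd _

theorem IsDirichletSpectrum.tendsto_atTop (hlam : IsDirichletSpectrum Ω lam) (hd : 1 ≤ d)
    (hbdd : Bornology.IsBounded (Ω : Set (EuclideanSpace ℝ (Fin d)))) :
    Tendsto lam atTop atTop := by
  obtain ⟨e, he⟩ := hlam.exists_equiv hd hbdd
  refine tendsto_atTop_atTop_of_monotone hlam.monotone fun N => ?_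
  by_contra! h
  refine Set.infinite_univ (α := ℕ) (((EigenIndex.finite_le hd hbdd N).preimage
    e.injective.injOn).subset fun k _ => ?_)
  simp only [Set.mem_preimage, Set.mem_ofPred_eq, he]
  exact (h k).le

theorem IsDirichletSpectrum.yang_inequality (hlam : IsDirichletSpectrum Ω lam) (hd : 1 ≤ d)
    (hbdd : Bornology.IsBounded (Ω : Set (EuclideanSpace ℝ (Fin d)))) {z : ℝ} (hz : 0 ≤ z)
    (s : Finset ℕ) (hs : ∀ k, k ∈ s ↔ lam k < z) :
    (d : ℝ) * ∑ k ∈ s, (z - lam k) ^ 2 ≤ 4 * ∑ k ∈ s, (z - lam k) * lam k := by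
  obtain ⟨e, he⟩ := hlam.exists_equiv hd hbdd
  have h := _root_.yang_inequality hd hbdd hz (s.map e.toEmbedding) fun i => by
    rw [Finset.mem_map_equiv, hs, ← he, Equiv.apply_symm_apply]
  simpa [he] using h

end Consequences

end

noncomputable section

section MonotoneFinite

theorem le_of_deriv_nonneg_off_finite {f f' : ℝ → ℝ} (S : Finset ℝ) {a b : ℝ} (hab : a ≤ b)
    (hf : ContinuousOn f (Set.Icc a b))
    (hd : ∀ x ∈ Set.Ioo a b, x ∉ S → HasDerivAt f (f' x) x ∧ 0 ≤ f' x) : f a ≤ f b := by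
  induction S using Finset.induction_on generalizing a b with
  | empty =>
    have hd' : ∀ x ∈ interior (Set.Icc a b), HasDerivAt f (f' x) x ∧ 0 ≤ f' x := fun x hx =>
      hd x (by simpa using hx) (by simp)
    refine monotoneOn_of_deriv_nonneg (convex_Icc a b) hf
      (fun x hx => (hd' x hx).1.differentiableAt.differentiableWithinAt)
      (fun x hx => (hd' x hx).1.deriv ▸ (hd' x hx).2) (Set.left_mem_Icc.2 hab)
      (Set.right_mem_Icc.2 hab) hab
  | insert s S _ ih =>
    by_cases hs : s ∈ Set.Ioo a b
    · refine (ih hs.1.le (hf.mono (Set.Icc_subset_Icc_right hs.2.le)) ?_).trans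
        (ih hs.2.le (hf.mono (Set.Icc_subset_Icc_left hs.1.le)) ?_)
      · intro x hx hxS
        exact hd x ⟨hx.1, hx.2.trans hs.2⟩ (by simp [hx.2.ne, hxS])
      · intro x hx hxS
        exact hd x ⟨hs.1.trans hx.1, hx.2⟩ (by simp [hx.1.ne', hxS])
    · refine ih hab hf fun x hx hxS => hd x hx ?_
      simp only [Finset.mem_insert, hxS, or_false]
      rintro rfl
      exact hs hx

end MonotoneFinite

section RieszTerm

/-- The summand `(z - l)₊^σ` of the Riesz mean. -/
def rieszTerm (σ l z : ℝ) : ℝ := if l < z then (z - l) ^ σ else 0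

theorem rieszTerm_of_lt {σ l z : ℝ} (h : l < z) : rieszTerm σ l z = (z - l) ^ σ := if_pos h

theorem rieszTerm_of_le {σ l z : ℝ} (h : z ≤ l) : rieszTerm σ l z = 0 := if_neg h.not_gt

theorem rieszTerm_eq_mul (σ l z : ℝ) : rieszTerm σ l z = rieszTerm (σ - 1) l z * (z - l) := by
  rcases lt_or_ge l z with h | h
  · rw [rieszTerm_of_lt h, rieszTerm_of_lt h, ← Real.rpow_add_one (sub_pos.2 h).ne',
      sub_add_cancel]
  · rw [rieszTerm_of_le h, rieszTerm_of_le h, zero_mul]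

theorem rieszTerm_eq_max_rpow {σ : ℝ} (hσ : 0 < σ) (l z : ℝ) :
    rieszTerm σ l z = max (z - l) 0 ^ σ := by
  rcases lt_or_ge l z with h | h
  · rw [rieszTerm_of_lt h, max_eq_left (sub_pos.2 h).le]
  · rw [rieszTerm_of_le h, max_eq_right (sub_nonpos.2 h), Real.zero_rpow hσ.ne']

theorem continuous_rieszTerm {σ : ℝ} (hσ : 0 < σ) (l : ℝ) : Continuous (rieszTerm σ l) := by
  rw [show rieszTerm σ l = fun z => max (z - l) 0 ^ σ from funext (rieszTerm_eq_max_rpow hσ l)]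
  exact Continuous.rpow_const (by fun_prop) fun _ => Or.inr hσ.le

theorem monotone_rieszTerm {σ : ℝ} (hσ : 0 < σ) (l : ℝ) : Monotone (rieszTerm σ l) := by
  intro z w hzw
  rw [rieszTerm_eq_max_rpow hσ, rieszTerm_eq_max_rpow hσ]
  gcongr

theorem hasDerivAt_rieszTerm {σ l z : ℝ} (h : 1 < σ ∨ l ≠ z) :
    HasDerivAt (rieszTerm σ l) (σ * rieszTerm (σ - 1) l z) z := by
  rcases lt_trichotomy l z with hlz | rfl | hlz
  · rw [rieszTerm_of_lt hlz]
    have h1 : HasDerivAt (fun w : ℝ => (w - l) ^ σ) (1 * σ * (z - l) ^ (σ - 1)) z :=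
      ((hasDerivAt_id z).sub_const l).rpow_const (Or.inl (sub_pos.2 hlz).ne')
    rw [one_mul] at h1
    refine h1.congr_of_eventuallyEq ?_
    filter_upwards [lt_mem_nhds hlz] with w hw
    exact rieszTerm_of_lt hw
  · have hσ : 1 < σ := h.resolve_right (by simp)
    rw [rieszTerm_of_le le_rfl, mul_zero, hasDerivAt_iff_tendsto_slope]
    have hc := ((continuous_rieszTerm (sub_pos.2 hσ) l).tendsto l).mono_left
      (nhdsWithin_le_nhds (s := {l}ᶜ))
    rw [rieszTerm_of_le le_rfl] at hc
    refine hc.congr' ?_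
    filter_upwards [self_mem_nhdsWithin] with w hw
    have hw' : w - l ≠ 0 := sub_ne_zero.2 hw
    rw [slope_def_field, rieszTerm_of_le (le_refl l), sub_zero, rieszTerm_eq_mul σ]
    field_simp
  · rw [rieszTerm_of_le hlz.le, mul_zero]
    refine (hasDerivAt_const z (0 : ℝ)).congr_of_eventuallyEq ?_
    filter_upwards [gt_mem_nhds hlz] with w hw
    exact rieszTerm_of_le hw.le

end RieszTerm

section BetaIntegral

theorem intervalIntegrable_sub_rpow {p : ℝ} (hp : -1 < p) (z a b : ℝ) :
    IntervalIntegrable (fun t => (z - t) ^ p) volume a b := by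
  have := (intervalIntegral.intervalIntegrable_rpow' hp (a := z - a) (b := z - b)).comp_sub_left z
  simpa using this

theorem integral_sub_rpow {p : ℝ} (hp : -1 < p) (l z : ℝ) :
    ∫ t in l..z, (z - t) ^ p = (z - l) ^ (p + 1) / (p + 1) := by
  rw [intervalIntegral.integral_comp_sub_left (fun x => x ^ p) z, integral_rpow (Or.inl hp),
    sub_self, Real.zero_rpow (by linarith), sub_zero]

theorem intervalIntegrable_sub_rpow_mul_rieszTerm {p q : ℝ} (hp : -1 < p) (hq : 0 < q)
    (l z a b : ℝ) :
    IntervalIntegrable (fun t => (z - t) ^ p * rieszTerm q l t) volume a b :=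
  (intervalIntegrable_sub_rpow hp z a b).mul_continuousOn (continuous_rieszTerm hq l).continuousOn

theorem integral_sub_rpow_mul_rieszTerm_of_lt {p q l z : ℝ} (hp : -1 < p) (hq : 0 < q)
    (hl : 0 ≤ l) (hlz : l < z) :
    ∫ t in 0..z, (z - t) ^ p * rieszTerm q l t = ∫ t in l..z, (z - t) ^ p * (t - l) ^ q := by
  rw [← intervalIntegral.integral_add_adjacent_intervals
    (intervalIntegrable_sub_rpow_mul_rieszTerm hp hq l z 0 l)
    (intervalIntegrable_sub_rpow_mul_rieszTerm hp hq l z l z)]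
  have h1 : ∫ t in 0..l, (z - t) ^ p * rieszTerm q l t = 0 := by
    refine (intervalIntegral.integral_congr (g := fun _ => (0 : ℝ)) fun t ht => ?_).trans
      intervalIntegral.integral_zero
    rw [Set.uIcc_of_le hl] at ht
    simp [rieszTerm_of_le ht.2]
  rw [h1, zero_add]
  refine intervalIntegral.integral_congr fun t ht => ?_
  rw [Set.uIcc_of_le hlz.le] at ht
  rw [rieszTerm_eq_max_rpow hq, max_eq_left (sub_nonneg.2 ht.1)]

theorem integral_sub_rpow_mul_rieszTerm_of_le {p q l z : ℝ} (hz : 0 ≤ z) (hlz : z ≤ l) :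
    ∫ t in 0..z, (z - t) ^ p * rieszTerm q l t = 0 := by
  refine (intervalIntegral.integral_congr (g := fun _ => (0 : ℝ)) fun t ht => ?_).trans
    intervalIntegral.integral_zero
  rw [Set.uIcc_of_le hz] at ht
  simp [rieszTerm_of_le (ht.2.trans hlz)]

theorem integral_sub_rpow_mul_rieszTerm_one {p l z : ℝ} (hp : -1 < p) (hl : 0 ≤ l) (hz : 0 ≤ z) :
    ∫ t in 0..z, (z - t) ^ p * rieszTerm 1 l t =
      rieszTerm (p + 2) l z / ((p + 1) * (p + 2)) := by
  rcases lt_or_ge l z with hlz | hlz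
  · rw [integral_sub_rpow_mul_rieszTerm_of_lt hp one_pos hl hlz, rieszTerm_of_lt hlz]
    have h0 : 0 < z - l := sub_pos.2 hlz
    have hcongr : ∫ t in l..z, (z - t) ^ p * (t - l) ^ (1 : ℝ) =
        ∫ t in l..z, ((z - l) * (z - t) ^ p - (z - t) ^ (p + 1)) := by
      refine intervalIntegral.integral_congr_ae ?_
      have hne : ∀ᵐ t : ℝ, t ≠ z := by simp [ae_iff]
      filter_upwards [hne] with t htz ht
      rw [Real.rpow_add_one (sub_ne_zero.2 htz.symm), Real.rpow_one]
      ring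
    rw [hcongr, intervalIntegral.integral_sub ((intervalIntegrable_sub_rpow hp z l z).const_mul _)
      (intervalIntegrable_sub_rpow (by linarith) z l z), intervalIntegral.integral_const_mul,
      integral_sub_rpow hp, integral_sub_rpow (by linarith),
      show p + 2 = p + 1 + 1 by ring, Real.rpow_add_one h0.ne' (p + 1)]
    have h1 : p + 1 ≠ 0 := by linarith
    have h2 : p + 1 + 1 ≠ 0 := by linarith
    field_simp
    ring
  · rw [integral_sub_rpow_mul_rieszTerm_of_le hz hlz, rieszTerm_of_le hlz, zero_div]

theorem integral_sub_rpow_mul_rieszTerm_two {p l z : ℝ} (hp : -1 < p) (hl : 0 ≤ l) (hz : 0 ≤ z) :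
    ∫ t in 0..z, (z - t) ^ p * rieszTerm 2 l t =
      2 * rieszTerm (p + 3) l z / ((p + 1) * (p + 2) * (p + 3)) := by
  rcases lt_or_ge l z with hlz | hlz
  · rw [integral_sub_rpow_mul_rieszTerm_of_lt hp two_pos hl hlz, rieszTerm_of_lt hlz]
    have h0 : 0 < z - l := sub_pos.2 hlz
    have hcongr : ∫ t in l..z, (z - t) ^ p * (t - l) ^ (2 : ℝ) =
        ∫ t in l..z, ((z - l) ^ 2 * (z - t) ^ p - (2 * (z - l) * (z - t) ^ (p + 1) -
          (z - t) ^ (p + 1 + 1))) := by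
      refine intervalIntegral.integral_congr_ae ?_
      have hne : ∀ᵐ t : ℝ, t ≠ z := by simp [ae_iff]
      filter_upwards [hne] with t htz ht
      rw [Real.rpow_add_one (sub_ne_zero.2 htz.symm) (p + 1),
        Real.rpow_add_one (sub_ne_zero.2 htz.symm), Real.rpow_two]
      ring
    have i0 := (intervalIntegrable_sub_rpow hp z l z).const_mul ((z - l) ^ 2)
    have i1 := (intervalIntegrable_sub_rpow (p := p + 1) (by linarith) z l z).const_mul
      (2 * (z - l))
    have i2 := intervalIntegrable_sub_rpow (p := p + 1 + 1) (by linarith) z l z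
    rw [hcongr, intervalIntegral.integral_sub i0 (i1.sub i2), intervalIntegral.integral_sub i1 i2,
      intervalIntegral.integral_const_mul, intervalIntegral.integral_const_mul,
      integral_sub_rpow hp, integral_sub_rpow (by linarith), integral_sub_rpow (by linarith),
      show p + 3 = p + 1 + 1 + 1 by ring, show p + 2 = p + 1 + 1 by ring,
      Real.rpow_add_one h0.ne' (p + 1 + 1), Real.rpow_add_one h0.ne' (p + 1)]
    have h1 : p + 1 ≠ 0 := by linarith
    have h2 : p + 1 + 1 ≠ 0 := by linarith
    have h3 : p + 1 + 1 + 1 ≠ 0 := by linarith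
    field_simp
    ring
  · rw [integral_sub_rpow_mul_rieszTerm_of_le hz hlz, rieszTerm_of_le hlz, mul_zero, zero_div]

end BetaIntegral

end

noncomputable section

section WeightedYang

/-- The weighted inequality for the exponent `2` gives that for all exponents `σ ≤ 2`. -/
theorem mul_sum_rieszTerm_le_of_le_two (s : Finset ℕ) (lam : ℕ → ℝ) {c σ z : ℝ} (hc : 0 < c)
    (hσ : σ ≤ 2) (hz : 0 < z)
    (hY : c * ∑ k ∈ s, rieszTerm 2 (lam k) z ≤ ∑ k ∈ s, rieszTerm 1 (lam k) z * lam k) :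
    c * ∑ k ∈ s, rieszTerm σ (lam k) z ≤ ∑ k ∈ s, rieszTerm (σ - 1) (lam k) z * lam k := by
  set y := c * z / (1 + c) with hy
  have hyz : 0 < z - y := by
    rw [hy, sub_pos, div_lt_iff₀ (by positivity)]
    nlinarith
  have hyc : y * (1 + c) = c * z := by
    rw [hy, div_mul_cancel₀ _ (by positivity)]
  have key : ∀ l : ℝ, (z - y) ^ (σ - 2) * (rieszTerm 1 l z * l - c * rieszTerm 2 l z) ≤
      rieszTerm (σ - 1) l z * l - c * rieszTerm σ l z := by
    intro l
    rcases lt_or_ge l z with h | h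
    · have h0 : 0 < z - l := sub_pos.2 h
      have e1 : (z - l) ^ (σ - 1) = (z - l) ^ (σ - 2) * (z - l) := by
        rw [← Real.rpow_add_one h0.ne']; congr 1; ring
      have e2 : (z - l) ^ σ = (z - l) ^ (σ - 2) * (z - l) ^ 2 := by
        rw [← Real.rpow_two, ← Real.rpow_add h0]; congr 1; ring
      simp only [rieszTerm_of_lt h, Real.rpow_one, Real.rpow_two, e1, e2]
      suffices hs : (z - y) ^ (σ - 2) * ((1 + c) * (l - y)) ≤
          (z - l) ^ (σ - 2) * ((1 + c) * (l - y)) by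
        have := mul_le_mul_of_nonneg_left hs h0.le
        have e3 : (1 + c) * (l - y) = l - c * (z - l) := by linear_combination -hyc
        rw [e3] at this
        linarith
      rcases le_total y l with hyl | hyl
      · exact mul_le_mul_of_nonneg_right
          (Real.rpow_le_rpow_of_nonpos h0 (by linarith) (by linarith))
          (mul_nonneg (by positivity) (sub_nonneg.2 hyl))
      · exact mul_le_mul_of_nonpos_right
          (Real.rpow_le_rpow_of_nonpos hyz (by linarith) (by linarith))
          (mul_nonpos_of_nonneg_of_nonpos (by positivity) (sub_nonpos.2 hyl))
    · simp [rieszTerm_of_le h]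
  have hsum := Finset.sum_le_sum fun k (_ : k ∈ s) => key (lam k)
  rw [← Finset.mul_sum, Finset.sum_sub_distrib, Finset.sum_sub_distrib, ← Finset.mul_sum,
    ← Finset.mul_sum] at hsum
  have := mul_nonneg (Real.rpow_nonneg hyz.le (σ - 2)) (sub_nonneg.2 hY)
  linarith

/-- The weighted inequality for the exponent `2` and all `t ≤ z` gives that for all `σ > 2`. -/
theorem mul_sum_rieszTerm_le_of_two_lt (s : Finset ℕ) (lam : ℕ → ℝ) (hlam : ∀ k, 0 ≤ lam k)
    {c σ z : ℝ} (hσ : 2 < σ) (hz : 0 ≤ z)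
    (hY : ∀ t, 0 ≤ t → t ≤ z →
      c * ∑ k ∈ s, rieszTerm 2 (lam k) t ≤ ∑ k ∈ s, rieszTerm 1 (lam k) t * lam k) :
    2 * c / σ * ∑ k ∈ s, rieszTerm σ (lam k) z ≤
      ∑ k ∈ s, rieszTerm (σ - 1) (lam k) z * lam k := by
  have hp : -1 < σ - 3 := by linarith
  have i2 : ∀ k ∈ s, IntervalIntegrable
      (fun t => c * ((z - t) ^ (σ - 3) * rieszTerm 2 (lam k) t)) volume 0 z := fun k _ =>
    (intervalIntegrable_sub_rpow_mul_rieszTerm hp two_pos (lam k) z 0 z).const_mul c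
  have i1 : ∀ k ∈ s, IntervalIntegrable
      (fun t => lam k * ((z - t) ^ (σ - 3) * rieszTerm 1 (lam k) t)) volume 0 z := fun k _ =>
    (intervalIntegrable_sub_rpow_mul_rieszTerm hp one_pos (lam k) z 0 z).const_mul (lam k)
  have hint : ∫ t in 0..z, ∑ k ∈ s, c * ((z - t) ^ (σ - 3) * rieszTerm 2 (lam k) t) ≤
      ∫ t in 0..z, ∑ k ∈ s, lam k * ((z - t) ^ (σ - 3) * rieszTerm 1 (lam k) t) := by
    refine intervalIntegral.integral_mono_on hz
      (by simpa only [Finset.sum_fn] using IntervalIntegrable.sum s i2)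
      (by simpa only [Finset.sum_fn] using IntervalIntegrable.sum s i1) fun t ht => ?_
    have h := mul_le_mul_of_nonneg_left (hY t ht.1 ht.2)
      (Real.rpow_nonneg (sub_nonneg.2 ht.2) (σ - 3))
    rw [Finset.mul_sum, Finset.mul_sum, Finset.mul_sum] at h
    refine (le_of_eq ?_).trans (h.trans (le_of_eq ?_))
    · exact Finset.sum_congr rfl fun k _ => by ring
    · exact Finset.sum_congr rfl fun k _ => by ring
  rw [intervalIntegral.integral_finsetSum i2, intervalIntegral.integral_finsetSum i1] at hint
  simp only [intervalIntegral.integral_const_mul, integral_sub_rpow_mul_rieszTerm_one hp (hlam _) hz,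
    integral_sub_rpow_mul_rieszTerm_two hp (hlam _) hz] at hint
  rw [show σ - 3 + 2 = σ - 1 by ring, show σ - 3 + 1 = σ - 2 by ring,
    show σ - 3 + 3 = σ by ring] at hint
  have hA : 0 < (σ - 2) * (σ - 1) := mul_pos (by linarith) (by linarith)
  have h := mul_le_mul_of_nonneg_left hint hA.le
  rw [Finset.mul_sum, Finset.mul_sum] at h
  rw [Finset.mul_sum]
  have h1 : σ - 2 ≠ 0 := by linarith
  have h2 : σ - 1 ≠ 0 := by linarith
  have h3 : σ ≠ 0 := by linarith
  refine (le_of_eq ?_).trans (h.trans (le_of_eq ?_))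
  · exact Finset.sum_congr rfl fun k _ => by field_simp
  · exact Finset.sum_congr rfl fun k _ => by field_simp

end WeightedYang

section RieszMean

variable {lam : ℕ → ℝ}

theorem exists_forall_le_of_tendsto (htend : Tendsto lam atTop atTop) (Z : ℝ) :
    ∃ N : ℕ, ∀ k, N ≤ k → Z ≤ lam k :=
  eventually_atTop.1 (htend.eventually_ge_atTop Z)

theorem rieszMean_eq_sum {N : ℕ} {Z z : ℝ} (hN : ∀ k, N ≤ k → Z ≤ lam k) (hz : z ≤ Z) (σ : ℝ) :
    rieszMean lam σ z = ∑ k ∈ Finset.range N, rieszTerm σ (lam k) z :=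
  tsum_eq_sum fun k hk => rieszTerm_of_le (hz.trans (hN k (by simpa using hk)))

theorem continuous_rieszMean (htend : Tendsto lam atTop atTop) {σ : ℝ} (hσ : 0 < σ) :
    Continuous (rieszMean lam σ) := by
  refine continuous_iff_continuousAt.2 fun z => ?_
  obtain ⟨N, hN⟩ := exists_forall_le_of_tendsto htend (z + 1)
  refine ContinuousAt.congr (f := fun w => ∑ k ∈ Finset.range N, rieszTerm σ (lam k) w) ?_ ?_
  · exact (continuous_finsetSum _ fun k _ => continuous_rieszTerm hσ (lam k)).continuousAt
  · filter_upwards [gt_mem_nhds (lt_add_one z)] with w hw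
    exact (rieszMean_eq_sum hN hw.le σ).symm

theorem hasDerivAt_rieszMean (htend : Tendsto lam atTop atTop) {σ z : ℝ}
    (h : 1 < σ ∨ ∀ k, lam k ≠ z) :
    HasDerivAt (rieszMean lam σ) (σ * rieszMean lam (σ - 1) z) z := by
  obtain ⟨N, hN⟩ := exists_forall_le_of_tendsto htend (z + 1)
  rw [rieszMean_eq_sum hN (by linarith), Finset.mul_sum]
  have hs : HasDerivAt (fun w => ∑ k ∈ Finset.range N, rieszTerm σ (lam k) w)
      (∑ k ∈ Finset.range N, σ * rieszTerm (σ - 1) (lam k) z) z :=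
    HasDerivAt.fun_sum fun k _ => hasDerivAt_rieszTerm (h.imp_right fun h => h k)
  refine hs.congr_of_eventuallyEq ?_
  filter_upwards [gt_mem_nhds (lt_add_one z)] with w hw
  exact rieszMean_eq_sum hN hw.le σ

/-- The lower derivative of `R_σ` is at least `σ R_{σ-1}`, also at the eigenvalues. -/
theorem eventually_lt_slope_rieszMean (htend : Tendsto lam atTop atTop) {σ z c : ℝ} (hσ : 0 < σ)
    (hc : c < σ * rieszMean lam (σ - 1) z) :
    ∀ᶠ w in 𝓝[≠] z, c < slope (rieszMean lam σ) z w := by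
  classical
  obtain ⟨N, hN⟩ := exists_forall_le_of_tendsto htend (z + 1)
  let s := (Finset.range N).filter fun k => lam k ≠ z
  let t := (Finset.range N).filter fun k => ¬ lam k ≠ z
  have hsplit : ∀ τ w, w ≤ z + 1 → rieszMean lam τ w =
      ∑ k ∈ s, rieszTerm τ (lam k) w + ∑ k ∈ t, rieszTerm τ (lam k) w := fun τ w hw => by
    rw [rieszMean_eq_sum hN hw, Finset.sum_filter_add_sum_filter_not]
  have ht0 : ∑ k ∈ t, rieszTerm (σ - 1) (lam k) z = 0 := Finset.sum_eq_zero fun k hk =>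
    rieszTerm_of_le (not_not.1 (Finset.mem_filter.1 hk).2).ge
  rw [hsplit _ z (by linarith), ht0, add_zero, Finset.mul_sum] at hc
  have hderiv : HasDerivAt (fun w => ∑ k ∈ s, rieszTerm σ (lam k) w)
      (∑ k ∈ s, σ * rieszTerm (σ - 1) (lam k) z) z :=
    HasDerivAt.fun_sum fun k hk => hasDerivAt_rieszTerm (Or.inr (Finset.mem_filter.1 hk).2)
  have hev := (hasDerivAt_iff_tendsto_slope.1 hderiv).eventually (lt_mem_nhds hc)
  filter_upwards [hev, nhdsWithin_le_nhds (gt_mem_nhds (lt_add_one z)), self_mem_nhdsWithin]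
    with w hw hwz hne
  refine hw.trans_le ?_
  have hmono : Monotone fun w => ∑ k ∈ t, rieszTerm σ (lam k) w := fun a b hab =>
    Finset.sum_le_sum fun k _ => monotone_rieszTerm hσ (lam k) hab
  have hnn : 0 ≤ slope (fun w => ∑ k ∈ t, rieszTerm σ (lam k) w) z w := by
    rw [slope_def_field]
    rcases le_total z w with h | h
    · exact div_nonneg (sub_nonneg.2 (hmono h)) (sub_nonneg.2 h)
    · exact div_nonneg_of_nonpos (sub_nonpos.2 (hmono h)) (sub_nonpos.2 h)
  have hadd : slope (rieszMean lam σ) z w = slope (fun w => ∑ k ∈ s, rieszTerm σ (lam k) w) z w +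
      slope (fun w => ∑ k ∈ t, rieszTerm σ (lam k) w) z w := by
    simp only [slope_def_field]
    rw [hsplit σ w hwz.le, hsplit σ z (by linarith)]
    ring
  rw [hadd]
  linarith

theorem monotoneOn_rieszMean_div_rpow (htend : Tendsto lam atTop atTop) (hpos : 0 < lam 0)
    {σ α : ℝ} (hσ : 0 < σ)
    (h : ∀ z, lam 0 ≤ z → α / z * rieszMean lam σ z ≤ σ * rieszMean lam (σ - 1) z) :
    MonotoneOn (fun z => rieszMean lam σ z / z ^ α) (Set.Ici (lam 0)) := by
  intro a ha b hb hab
  have ha0 : 0 < a := hpos.trans_le ha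
  obtain ⟨N, hN⟩ := exists_forall_le_of_tendsto htend b
  refine le_of_deriv_nonneg_off_finite (f := fun z => rieszMean lam σ z / z ^ α)
    (f' := fun x => (σ * rieszMean lam (σ - 1) x * x ^ α -
      rieszMean lam σ x * (α * x ^ (α - 1))) / (x ^ α) ^ 2)
    ((Finset.range N).image lam) hab ?_ ?_
  · refine (continuous_rieszMean htend hσ).continuousOn.div ?_ ?_
    · exact continuousOn_id.rpow_const fun x hx => Or.inl (ha0.trans_le hx.1).ne'
    · exact fun x hx => (Real.rpow_pos_of_pos (ha0.trans_le hx.1) α).ne'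
  · intro x hx hxS
    have hx0 : 0 < x := ha0.trans hx.1
    have hne : ∀ k, lam k ≠ x := by
      intro k hk
      by_cases hkN : k < N
      · exact hxS (Finset.mem_image.2 ⟨k, Finset.mem_range.2 hkN, hk⟩)
      · exact absurd (hN k (not_lt.1 hkN)) (by rw [hk]; exact hx.2.not_ge)
    constructor
    · exact (hasDerivAt_rieszMean htend (Or.inr hne)).div
        (Real.hasDerivAt_rpow_const (Or.inl hx0.ne')) (Real.rpow_pos_of_pos hx0 α).ne'
    · refine div_nonneg ?_ (sq_nonneg _)
      have e : x ^ α = x ^ (α - 1) * x := by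
        rw [← Real.rpow_add_one hx0.ne', sub_add_cancel]
      have h1 := h x (ha.trans hx.1.le)
      have h2 := mul_le_mul_of_nonneg_left h1 (Real.rpow_nonneg hx0.le α)
      have h3 : x ^ α * (α / x * rieszMean lam σ x) =
          rieszMean lam σ x * (α * x ^ (α - 1)) := by
        rw [e]
        field_simp
      linarith

end RieszMean

section Main

variable {d : ℕ} {Ω : Opens (EuclideanSpace ℝ (Fin d))} {lam : ℕ → ℝ}

theorem IsDirichletSpectrum.yang_inequality_rieszTerm (hlam : IsDirichletSpectrum Ω lam)
    (hd : 1 ≤ d) (hbdd : Bornology.IsBounded (Ω : Set (EuclideanSpace ℝ (Fin d)))) {N : ℕ} {Z : ℝ}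
    (hN : ∀ k, N ≤ k → Z ≤ lam k) {t : ℝ} (ht : 0 ≤ t) (htZ : t ≤ Z) :
    (d : ℝ) / 4 * ∑ k ∈ Finset.range N, rieszTerm 2 (lam k) t ≤
      ∑ k ∈ Finset.range N, rieszTerm 1 (lam k) t * lam k := by
  have h := hlam.yang_inequality hd hbdd ht ((Finset.range N).filter fun k => lam k < t) fun k => by
    rw [Finset.mem_filter, Finset.mem_range, and_iff_right_iff_imp]
    intro hk
    by_contra hkN
    exact absurd (htZ.trans (hN k (not_lt.1 hkN))) hk.not_ge
  rw [Finset.sum_filter, Finset.sum_filter] at h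
  have e2 : ∀ k, rieszTerm 2 (lam k) t = if lam k < t then (t - lam k) ^ 2 else 0 := fun k => by
    simp only [rieszTerm, Real.rpow_two]
  have e1 : ∀ k, rieszTerm 1 (lam k) t * lam k =
      if lam k < t then (t - lam k) * lam k else 0 := fun k => by
    simp only [rieszTerm, Real.rpow_one, ite_mul, zero_mul]
  simp only [e1, e2]
  linarith

theorem IsDirichletSpectrum.le_rieszMean_sub_one (hlam : IsDirichletSpectrum Ω lam)
    (hd : 1 ≤ d) (hbdd : Bornology.IsBounded (Ω : Set (EuclideanSpace ℝ (Fin d)))) {σ κ z : ℝ}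
    (hκ : σ ≤ 2 ∧ κ = (d : ℝ) / 4 ∨ 2 ≤ σ ∧ κ = (d : ℝ) / (2 * σ)) (hz : 0 < z) :
    (1 + κ) * (1 / z) * rieszMean lam σ z ≤ rieszMean lam (σ - 1) z := by
  have hd' : (0 : ℝ) < d := by exact_mod_cast hd
  obtain ⟨N, hN⟩ := exists_forall_le_of_tendsto (hlam.tendsto_atTop hd hbdd) z
  have key : κ * ∑ k ∈ Finset.range N, rieszTerm σ (lam k) z ≤
      ∑ k ∈ Finset.range N, rieszTerm (σ - 1) (lam k) z * lam k := by
    have hsmall : σ ≤ 2 → (d : ℝ) / 4 * ∑ k ∈ Finset.range N, rieszTerm σ (lam k) z ≤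
        ∑ k ∈ Finset.range N, rieszTerm (σ - 1) (lam k) z * lam k := fun hσ =>
      mul_sum_rieszTerm_le_of_le_two _ _ (by positivity) hσ hz
        (hlam.yang_inequality_rieszTerm hd hbdd hN hz.le le_rfl)
    rcases hκ with ⟨hσ, rfl⟩ | ⟨hσ, rfl⟩
    · exact hsmall hσ
    · rcases hσ.eq_or_lt with rfl | hσ
      · convert hsmall le_rfl using 3
        norm_num
      · have h := mul_sum_rieszTerm_le_of_two_lt (Finset.range N) lam
          (fun k => (hlam.pos hd hbdd k).le) hσ hz.le
          (fun t ht htz => hlam.yang_inequality_rieszTerm hd hbdd hN ht htz)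
        convert h using 2
        have : σ ≠ 0 := by linarith
        field_simp
        norm_num
  rw [rieszMean_eq_sum hN le_rfl, rieszMean_eq_sum hN le_rfl]
  have hsplit : z * ∑ k ∈ Finset.range N, rieszTerm (σ - 1) (lam k) z =
      ∑ k ∈ Finset.range N, rieszTerm σ (lam k) z +
        ∑ k ∈ Finset.range N, rieszTerm (σ - 1) (lam k) z * lam k := by
    rw [Finset.mul_sum, ← Finset.sum_add_distrib]
    refine Finset.sum_congr rfl fun k _ => ?_
    rw [rieszTerm_eq_mul σ]
    ring
  rw [mul_one_div, div_mul_eq_mul_div, div_le_iff₀ hz, mul_comm _ z, hsplit]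
  linarith

end Main

end

theorem theorem2p1 {d : ℕ} (hd : 1 ≤ d) (Ω : Opens (EuclideanSpace ℝ (Fin d)))
    (hne : (Ω : Set (EuclideanSpace ℝ (Fin d))).Nonempty)
    (hbdd : Bornology.IsBounded (Ω : Set (EuclideanSpace ℝ (Fin d)))) :
    (∃ lam : ℕ → ℝ, IsDirichletSpectrum Ω lam) ∧
    ∀ lam : ℕ → ℝ, IsDirichletSpectrum Ω lam →
      0 < lam 0 ∧ Tendsto lam atTop atTop ∧
      (∀ σ : ℝ, 0 < σ → σ ≤ 2 →
        (∀ z : ℝ, lam 0 ≤ z →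
          rieszMean lam (σ - 1) z ≥ (1 + (d : ℝ) / 4) * (1 / z) * rieszMean lam σ z) ∧
        (∀ z : ℝ, lam 0 ≤ z → (1 < σ ∨ ∀ k, lam k ≠ z) →
          DifferentiableAt ℝ (rieszMean lam σ) z ∧
          deriv (rieszMean lam σ) z ≥ (1 + (d : ℝ) / 4) * (σ / z) * rieszMean lam σ z) ∧
        (∀ z : ℝ, lam 0 ≤ z →
          ∀ c : ℝ, c < (1 + (d : ℝ) / 4) * (σ / z) * rieszMean lam σ z →
            ∀ᶠ w in 𝓝[≠] z, c < slope (rieszMean lam σ) z w) ∧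
        MonotoneOn (fun z : ℝ => rieszMean lam σ z / z ^ (σ + (d : ℝ) * σ / 4))
          (Set.Ici (lam 0))) ∧
      (∀ σ : ℝ, 2 ≤ σ →
        (∀ z : ℝ, lam 0 ≤ z →
          rieszMean lam (σ - 1) z ≥ (1 + (d : ℝ) / (2 * σ)) * (1 / z) * rieszMean lam σ z) ∧
        (∀ z : ℝ, lam 0 ≤ z →
          DifferentiableAt ℝ (rieszMean lam σ) z ∧
          deriv (rieszMean lam σ) z ≥ (σ + (d : ℝ) / 2) * (1 / z) * rieszMean lam σ z) ∧
        MonotoneOn (fun z : ℝ => rieszMean lam σ z / z ^ (σ + (d : ℝ) / 2))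
          (Set.Ici (lam 0))) := by
  refine ⟨exists_isDirichletSpectrum hd hne hbdd, fun lam hlam => ?_⟩
  have hpos : 0 < lam 0 := hlam.pos hd hbdd 0
  have htend := hlam.tendsto_atTop hd hbdd
  refine ⟨hpos, htend, fun σ hσ0 hσ2 => ?_, fun σ hσ2 => ?_⟩
  · have h1 : ∀ z, lam 0 ≤ z →
        (1 + (d : ℝ) / 4) * (1 / z) * rieszMean lam σ z ≤ rieszMean lam (σ - 1) z := fun z hz =>
      hlam.le_rieszMean_sub_one hd hbdd (Or.inl ⟨hσ2, rfl⟩) (hpos.trans_le hz)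
    have h2 : ∀ z, lam 0 ≤ z →
        (1 + (d : ℝ) / 4) * (σ / z) * rieszMean lam σ z ≤ σ * rieszMean lam (σ - 1) z := by
      intro z hz
      refine (le_of_eq ?_).trans (mul_le_mul_of_nonneg_left (h1 z hz) hσ0.le)
      ring
    refine ⟨h1, fun z hz h => ?_, fun z hz c hc => ?_, ?_⟩
    · have hderiv := hasDerivAt_rieszMean htend h
      exact ⟨hderiv.differentiableAt, hderiv.deriv ▸ h2 z hz⟩
    · exact eventually_lt_slope_rieszMean htend hσ0 (hc.trans_le (h2 z hz))
    · refine monotoneOn_rieszMean_div_rpow htend hpos hσ0 fun z hz => ?_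
      refine (le_of_eq ?_).trans (h2 z hz)
      ring
  · have hσ0 : 0 < σ := by linarith
    have h1 : ∀ z, lam 0 ≤ z →
        (1 + (d : ℝ) / (2 * σ)) * (1 / z) * rieszMean lam σ z ≤ rieszMean lam (σ - 1) z :=
      fun z hz => hlam.le_rieszMean_sub_one hd hbdd (Or.inr ⟨hσ2, rfl⟩) (hpos.trans_le hz)
    have h2 : ∀ z, lam 0 ≤ z →
        (σ + (d : ℝ) / 2) * (1 / z) * rieszMean lam σ z ≤ σ * rieszMean lam (σ - 1) z := by
      intro z hz
      refine (le_of_eq ?_).trans (mul_le_mul_of_nonneg_left (h1 z hz) hσ0.le)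
      field_simp
    refine ⟨h1, fun z hz => ?_, ?_⟩
    · have hderiv := hasDerivAt_rieszMean htend (σ := σ) (z := z) (Or.inl (by linarith))
      exact ⟨hderiv.differentiableAt, hderiv.deriv ▸ h2 z hz⟩
    · refine monotoneOn_rieszMean_div_rpow htend hpos hσ0 fun z hz => ?_
      refine (le_of_eq ?_).trans (h2 z hz)
      ring
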